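/- A copy of a graph $H$ in a finite graph $G$ is called singular if its vertices either all have the same degree in $G$ or have pairwise distinct degrees in $G$. Let $T_S(n,H)$ be the largest number of edges of an $n$-vertex graph containing no singular copy of $H$, let $t(n,q)$ be the number of edges of the balanced complete $q$-partite graph on $n$ vertices, and let $t'(n,r^2)$ be the largest number of edges of a complete $r^2$-partite graph on $n$ vertices (with nonempty parts) that contains no singular copy of $K_{r+1}$. Fix an integer $r\ge 3$. (i) For every sufficiently large $n$ divisible by $r$ we have $$T_S(n,K_{r+1})=t'(n,r^2),$$ and $t'(n,r^2)$ is also the largest number of edges of a complete $r^2$-partite graph on $n$ vertices whose parts have exactly $r$ different sizes, each size occurring exactly $r$ times. Moreover, there is, up to isomorphism, exactly one such complete $r^2$-partite graph on $n$ vertices ($r$ different part sizes, each occurring exactly $r$ times) whose smallest and largest part sizes differ by at most $r$, and an $n$-vertex graph without a singular copy of $K_{r+1}$ has $T_S(n,K_{r+1})$ edges if and only if it is isomorphic to this graph. (ii) There is a real constant $C_r$ depending only on $r$ such that for all $n=rk+m$ with integers $k\ge 0$ and $1\le m<r$, $$t(n,r^2)-m\,\frac{r-1}{r^2}\,n+C_r\;\le\;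 T_S(n,K_{r+1})\;\le\; t(n,r^2)-\frac{n}{r^2}+\sqrt{n}.$$ -/

import Mathlib

namespace SingularTuran

open Finset

/-- A copy of `H` in `G` is singular if its vertices either all have the same degree in `G`, or
have pairwise distinct degrees in `G`. -/
def IsSingularCopy {V W : Type*} {G : SimpleGraph V} [G.LocallyFinite] {H : SimpleGraph W}
    (f : H.Copy G) : Prop :=
  (∀ u v : W, G.degree (f u) = G.degree (f v)) ∨
    (∀ u v : W, u ≠ v → G.degree (f u) ≠ G.degree (f v))

open Classical in
/-- `G` contains no singular copy of `H`. -/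
def SingularFree {V W : Type*} [Fintype V] (H : SimpleGraph W) (G : SimpleGraph V) : Prop :=
  ∀ f : H.Copy G, ¬ IsSingularCopy f

open Classical in
/-- The number of edges of a finite graph. -/
noncomputable def numEdges {V : Type*} [Fintype V] (G : SimpleGraph V) : ℕ :=
  #G.edgeFinset

open Classical in
/-- The singular Turán number `T_S(n, H)`: the largest number of edges of a graph on `n` vertices
without a singular copy of `H`. -/
noncomputable def singularTuranNumber (n : ℕ) {W : Type*} (H : SimpleGraph W) : ℕ :=
  sup {G : SimpleGraph (Fin n) | SingularFree H G} numEdges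

/-- `t(n, q)`: the number of edges of the balanced complete `q`-partite graph on `n` vertices. -/
noncomputable def turanEdges (n q : ℕ) : ℕ :=
  numEdges (SimpleGraph.turanGraph n q)

/-- `G` is (isomorphic to) the complete `q`-partite graph with (nonempty) parts of sizes
`s 0, …, s (q - 1)`. -/
def IsCompletePartite {V : Type*} {q : ℕ} (s : Fin q → ℕ) (G : SimpleGraph V) : Prop :=
  (∀ i, 0 < s i) ∧ Nonempty (G ≃g SimpleGraph.completeMultipartiteGraph fun i => Fin (s i))

open Classical in
/-- `t'(n, r²)`: the largest number of edges of a complete `r²`-partite graph on `n` vertices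
without a singular copy of `K_{r+1}`. (The value is `0` if there is no such graph.) -/
noncomputable def turanEdges' (n r : ℕ) : ℕ :=
  sup {G : SimpleGraph (Fin n) | (∃ s : Fin (r ^ 2) → ℕ, IsCompletePartite s G) ∧
    SingularFree (SimpleGraph.completeGraph (Fin (r + 1))) G} numEdges

/-- The `r²` part sizes take exactly `r` values, and each of these is taken exactly `r` times. -/
def PropertyR {r : ℕ} (s : Fin (r ^ 2) → ℕ) : Prop :=
  #(univ.image s) = r ∧ ∀ x ∈ univ.image s, #{i | s i = x} = r

/-- `G` is a complete `r²`-partite graph with `r` part sizes, each appearing `r` times, such that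
the smallest and the largest part sizes differ by at most `r`. -/
def IsBalancedPropertyR {V : Type*} (r : ℕ) (G : SimpleGraph V) : Prop :=
  ∃ s : Fin (r ^ 2) → ℕ, IsCompletePartite s G ∧ PropertyR s ∧ ∀ i j, s j ≤ s i + r

end SingularTuran

/-! In a clique of a graph without a singular `K_{r+1}`, each degree occurs at most `r` times and at
most `r` degrees occur. So cliques have at most `r ^ 2` vertices, and Turán's theorem applies with
`q = r ^ 2` parts.

By the stability bound `adjIn_le_of_not_colorable`, a graph without `K_{q+1}` that is not
`q`-colourable has about `n / q` edges fewer than the Turán graph. A denser graph without a singular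
`K_{r+1}` is therefore `q`-colourable, and so few differently coloured pairs are nonadjacent that
every class contains a vertex joined to all other classes. These vertices form a clique whose
degrees are `n` minus the class sizes, and the equality case of the pigeonhole count forces `r`
sizes, each occurring `r` times (`SingularFree.exists_coloring`). In particular `r ∣ n`, whence the
upper bound of (ii).

When `r ∣ n`, it remains to minimise the sum of squares over sets of `r` naturals with sum `n / r`.
The unique optimum is the set of diameter at most `r` (`sum_sq_le_of_balanced`), which gives (i).
For the lower bound of (ii), `m` independent vertices are added to the extremal graph on `r * k`
vertices and joined to every part not of the largest size (`singularFree_adjoinVertices`). -/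

namespace SingularTuran

open Finset
open scoped Classical

/-- The number of neighbours of `v` in `S`. -/
noncomputable def degIn {V : Type*} (G : SimpleGraph V) (S : Finset V) (v : V) : ℕ :=
  #{w ∈ S | G.Adj v w}

/-- Twice the number of edges inside `A`. -/
noncomputable def adjIn {V : Type*} (G : SimpleGraph V) (A : Finset V) : ℕ :=
  ∑ v ∈ A, degIn G A v

/-- The ordered nonadjacent pairs of vertices of `A` with different colours. -/
noncomputable def crossNonadj {V ι : Type*} [DecidableEq ι] (G : SimpleGraph V) (A : Finset V)
    (c : V → ι) : Finset (V × V) :=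
  {p ∈ A ×ˢ A | c p.1 ≠ c p.2 ∧ ¬ G.Adj p.1 p.2}

/-! ### Counting adjacent pairs across a vertex colouring -/

section

variable {V ι : Type*} {G : SimpleGraph V}

lemma adjIn_add_sum_sq_add_crossNonadj [Fintype ι] [DecidableEq ι] {A : Finset V} {c : V → ι}
    (hc : ∀ v ∈ A, ∀ w ∈ A, G.Adj v w → c v ≠ c w) :
    adjIn G A + ∑ i, #{v ∈ A | c v = i} ^ 2 + #(crossNonadj G A c) = #A ^ 2 := by
  have h1 : adjIn G A = #{p ∈ A ×ˢ A | G.Adj p.1 p.2} := by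
    simp only [adjIn, degIn, card_filter, sum_product]
  have h2 : ∑ i, #{v ∈ A | c v = i} ^ 2 = #{p ∈ A ×ˢ A | c p.1 = c p.2} := by
    rw [card_eq_sum_card_fiberwise (f := fun p : V × V => c p.1) (t := univ) (by simp)]
    refine sum_congr rfl fun i _ => ?_
    rw [sq, ← card_product]
    congr 1
    ext ⟨a, b⟩
    simp only [mem_product, mem_filter]
    constructor
    · rintro ⟨⟨h, rfl⟩, h', h''⟩; exact ⟨⟨⟨h, h'⟩, h''.symm⟩, rfl⟩
    · rintro ⟨⟨⟨h, h'⟩, h''⟩, rfl⟩; exact ⟨⟨h, rfl⟩, h', h''.symm⟩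
  have h3 : #{p ∈ A ×ˢ A | c p.1 ≠ c p.2} =
      #{p ∈ A ×ˢ A | G.Adj p.1 p.2} + #(crossNonadj G A c) := by
    rw [crossNonadj, ← card_union_of_disjoint]
    · congr 1
      ext ⟨a, b⟩
      simp only [mem_filter, mem_union, mem_product]
      constructor
      · rintro ⟨⟨h, h'⟩, h''⟩
        by_cases hab : G.Adj a b
        · exact Or.inl ⟨⟨h, h'⟩, hab⟩
        · exact Or.inr ⟨⟨h, h'⟩, h'', hab⟩
      · rintro (⟨⟨h, h'⟩, h''⟩ | ⟨⟨h, h'⟩, h'', -⟩)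
        · exact ⟨⟨h, h'⟩, hc _ h _ h' h''⟩
        · exact ⟨⟨h, h'⟩, h''⟩
    · rw [disjoint_filter]
      rintro p - h ⟨-, h'⟩
      exact h' h
  have h4 := card_filter_add_card_filter_not (s := A ×ˢ A) (fun p => c p.1 = c p.2)
  rw [card_product, ← sq] at h4
  rw [h1, h2]
  simp only [ne_eq] at h3
  omega

/-- If no vertex of class `i` in `N` were complete to the other classes, each would occur in a bad
ordered pair once as first and once as second entry. These two families are disjoint, hence the
factor 2. -/
lemma exists_full_transversal [DecidableEq ι] {A N : Finset V} {c : V → ι} (hN : N ⊆ A)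
    (h : ∀ i, #(crossNonadj G A c) < 2 * #{v ∈ N | c v = i}) :
    ∃ w : ι → V, ∀ i, w i ∈ N ∧ c (w i) = i ∧ ∀ u ∈ A, c u ≠ i → G.Adj (w i) u := by
  suffices H : ∀ i, ∃ w ∈ N, c w = i ∧ ∀ u ∈ A, c u ≠ i → G.Adj w u by
    choose w hw using H
    exact ⟨w, fun i => hw i⟩
  intro i
  by_contra! hcon
  have h1 : #{v ∈ N | c v = i} ≤ #{p ∈ crossNonadj G A c | c p.1 = i} := by
    refine (card_le_card fun v hv => ?_).trans (card_image_le (f := Prod.fst))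
    obtain ⟨hvN, hvi⟩ := mem_filter.1 hv
    obtain ⟨u, hu, hui, hvu⟩ := hcon v hvN hvi
    exact mem_image.2 ⟨(v, u), by simp [crossNonadj, hN hvN, hu, hvi, hui.symm, hvu], rfl⟩
  have h2 : #{v ∈ N | c v = i} ≤ #{p ∈ crossNonadj G A c | ¬ c p.1 = i} := by
    refine (card_le_card fun v hv => ?_).trans (card_image_le (f := Prod.snd))
    obtain ⟨hvN, hvi⟩ := mem_filter.1 hv
    obtain ⟨u, hu, hui, hvu⟩ := hcon v hvN hvi
    exact mem_image.2 ⟨(u, v), by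
      simp [crossNonadj, hN hvN, hu, hvi, hui, G.adj_comm u v, hvu], rfl⟩
  have h3 := card_filter_add_card_filter_not (s := crossNonadj G A c) (fun p => c p.1 = i)
  have := h i
  omega

lemma degIn_union {S T : Finset V} (h : Disjoint S T) (v : V) :
    degIn G (S ∪ T) v = degIn G S v + degIn G T v := by
  rw [degIn, filter_union, card_union_of_disjoint (disjoint_filter_filter h)]; rfl

lemma sum_degIn_comm (S T : Finset V) : ∑ v ∈ S, degIn G T v = ∑ v ∈ T, degIn G S v := by
  refine (sum_card_bipartiteAbove_eq_sum_card_bipartiteBelow G.Adj).trans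
    (sum_congr rfl fun v _ => ?_)
  simp only [degIn, bipartiteBelow, G.adj_comm v]

lemma adjIn_union {S T : Finset V} (h : Disjoint S T) :
    adjIn G (S ∪ T) = adjIn G S + 2 * ∑ v ∈ T, degIn G S v + adjIn G T := by
  simp only [adjIn, sum_union h, degIn_union h, sum_add_distrib]
  rw [sum_degIn_comm S T]
  ring

/-- The number of edges meeting an edge `yz` is a lower bound for the number of all edges. -/
lemma two_mul_degIn_add_degIn_le_adjIn {B : Finset V} {y z : V} (hy : y ∈ B) (hz : z ∈ B)
    (hyz : G.Adj y z) : 2 * (degIn G B y + degIn G B z) ≤ adjIn G B + 2 := by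
  have hne := hyz.ne
  have hzB : z ∈ B.erase y := mem_erase.2 ⟨hne.symm, hz⟩
  set R := (B.erase y).erase z with hR
  have e1 : adjIn G B = degIn G B y + (degIn G B z + ∑ v ∈ R, degIn G B v) := by
    rw [adjIn, ← add_sum_erase _ _ hy, ← add_sum_erase _ _ hzB]
  have e2 : ∑ v ∈ R, degIn G {y, z} v ≤ ∑ v ∈ R, degIn G B v := by
    refine sum_le_sum fun v _ => card_le_card (filter_subset_filter _ ?_)
    intro x hx
    rcases mem_insert.1 hx with rfl | hx
    · exact hy
    · rwa [mem_singleton.1 hx]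
  rw [sum_degIn_comm, sum_pair hne] at e2
  have e3 : ∀ x ∈ B, degIn G R x + degIn G {y, z} x = degIn G B x := by
    intro x _
    rw [← degIn_union]
    · congr 1
      ext a
      simp only [hR, mem_union, mem_erase, mem_insert, mem_singleton]
      constructor
      · rintro (h | rfl | rfl)
        exacts [h.2.2, hy, hz]
      · tauto
    · simp [hR]
  have e4 := e3 y hy
  have e5 := e3 z hz
  have e6 : degIn G {y, z} y ≤ 1 := by
    simp [degIn, filter_insert, filter_singleton]
    split_ifs
    all_goals simp
  have e7 : degIn G {y, z} z ≤ 1 := by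
    simp [degIn, filter_insert, filter_singleton]
    split_ifs
    all_goals simp
  omega

end

/-! ### Stability for Turán's theorem: cliques versus colourability -/

section

variable {V : Type*} {G : SimpleGraph V}

lemma pairwise_adj_cons {p : ℕ} {w : Fin p → V} {x : V}
    (hw : ∀ i j, i ≠ j → G.Adj (w i) (w j)) (hx : ∀ i, G.Adj x (w i)) :
    ∀ i j, i ≠ j →
      G.Adj ((Fin.cons x w : Fin (p + 1) → V) i) ((Fin.cons x w : Fin (p + 1) → V) j) := by
  intro i j
  refine Fin.cases ?_ (fun i => ?_) i <;> refine Fin.cases ?_ (fun j => ?_) j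
  · simp
  · intro _; simpa using hx j
  · intro _; simpa using (hx i).symm
  · intro h
    simpa using hw i j (fun h' => h (by rw [h']))

/-- With `t` the mean of the `p + 2` numbers `V j` and `b`, the defect is a sum of squares, with `V
i - t + 1` absorbing the linear term `2 * V i`. -/
lemma sq_sum_bound {p : ℕ} (V : Fin (p + 1) → ℝ) (b : ℝ) (i : Fin (p + 1)) :
    (∑ j, V j) ^ 2 + 2 * (∑ j, V j) * b - ∑ j, V j ^ 2 - 2 * V i + 2 ≤
      (1 - 1 / ((p : ℝ) + 2)) * (∑ j, V j + b) ^ 2 - 2 * (∑ j, V j + b) / ((p : ℝ) + 2) + 3 := by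
  set D := ∑ j, V j with hD
  set t := (D + b) / ((p : ℝ) + 2) with ht
  have hp : (0 : ℝ) < (p : ℝ) + 2 := by positivity
  have htn : D + b = t * (p + 2) := by rw [ht]; field_simp
  have e1 : ∑ j, (V j - t) ^ 2 = ∑ j, V j ^ 2 - 2 * t * D + (p + 1) * t ^ 2 := by
    simp only [sub_sq, sum_add_distrib, sum_sub_distrib, ← sum_mul, ← mul_sum, ← hD]
    simp
    ring
  have e2 : (V i - t) ^ 2 ≤ ∑ j, (V j - t) ^ 2 :=
    single_le_sum (f := fun j => (V j - t) ^ 2) (fun _ _ => sq_nonneg _) (mem_univ i)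
  have e3 : (1 - 1 / ((p : ℝ) + 2)) * (D + b) ^ 2 - 2 * (D + b) / ((p : ℝ) + 2) =
      (p + 1) * (p + 2) * t ^ 2 - 2 * t := by
    rw [htn]; field_simp; ring
  have e4 : b = t * (p + 2) - D := by linarith
  rw [e3, e4]
  nlinarith [sq_nonneg (V i - t + 1), sq_nonneg (D - t * (p + 1))]

/-- The induction step of the stability bound. The constant `4 - 1 / (p + 1)` there is chosen so
that the difference of the two sides is a perfect square over `(p + 1) * (p + 2)`. -/
lemma max_degree_bound (p : ℕ) (D b : ℝ) :
    (1 - 1 / ((p : ℝ) + 1)) * D ^ 2 - 2 * D / ((p : ℝ) + 1) + 4 - 1 / ((p : ℝ) + 1) + 2 * D * b ≤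
      (1 - 1 / ((p : ℝ) + 2)) * (D + b) ^ 2 - 2 * (D + b) / ((p : ℝ) + 2) + 4
        - 1 / ((p : ℝ) + 2) := by
  have hp : (0 : ℝ) < (p : ℝ) + 2 := by positivity
  have hp' : (0 : ℝ) < (p : ℝ) + 1 := by positivity
  have key : (1 - 1 / ((p : ℝ) + 2)) * (D + b) ^ 2 - 2 * (D + b) / ((p : ℝ) + 2) + 4
        - 1 / ((p : ℝ) + 2) - ((1 - 1 / ((p : ℝ) + 1)) * D ^ 2 - 2 * D / ((p : ℝ) + 1) + 4
        - 1 / ((p : ℝ) + 1) + 2 * D * b) =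
      (D - (p + 1) * b + 1) ^ 2 / ((p + 1) * (p + 2)) := by
    field_simp
    ring
  have : 0 ≤ (D - (p + 1) * b + 1) ^ 2 / (((p : ℝ) + 1) * (p + 2)) := by positivity
  linarith

/-- A graph without a clique on `p + 2` vertices which is not `(p + 1)`-colourable misses the Turán
bound by a linear term. -/
theorem adjIn_le_of_not_colorable (p : ℕ) : ∀ A : Finset V,
    (∀ w : Fin (p + 2) → V, (∀ i, w i ∈ A) → ¬ ∀ i j, i ≠ j → G.Adj (w i) (w j)) →
    (¬ ∃ c : V → Fin (p + 1), ∀ v ∈ A, ∀ w ∈ A, G.Adj v w → c v ≠ c w) →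
    (adjIn G A : ℝ) ≤ (1 - 1 / ((p : ℝ) + 1)) * (#A : ℝ) ^ 2 - 2 * (#A : ℝ) / ((p : ℝ) + 1)
      + 4 - 1 / ((p : ℝ) + 1) := by
  induction p with
  | zero =>
    intro A hA hc
    refine absurd ⟨fun _ => 0, fun v hv w hw hvw => ?_⟩ hc
    refine absurd ?_ (hA ![v, w] ?_)
    · intro i j hij
      fin_cases i <;> fin_cases j <;> simp_all [G.adj_comm]
    · intro i
      fin_cases i <;> simp_all
  | succ p ih =>
    intro A hA hc
    have hne : A.Nonempty := by
      rw [nonempty_iff_ne_empty]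
      rintro rfl
      exact hc ⟨fun _ => 0, by simp⟩
    obtain ⟨x, hxA, hx⟩ := exists_max_image A (degIn G A) hne
    set S := {w ∈ A | G.Adj x w} with hS
    set B := {w ∈ A | ¬ G.Adj x w} with hB
    have hSA : S ⊆ A := filter_subset _ _
    have hBA : B ⊆ A := filter_subset _ _
    have hdisj : Disjoint S B := disjoint_filter_filter_not _ _ _
    have hunion : S ∪ B = A := filter_union_filter_not_eq _ _
    have hxS : degIn G A x = #S := rfl
    have hdeg : ∀ v ∈ B, degIn G S v + degIn G B v ≤ #S := by
      intro v hv
      rw [← degIn_union hdisj, hunion, ← hxS]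
      exact hx v (hBA hv)
    have hsum : adjIn G A = adjIn G S + 2 * ∑ v ∈ B, degIn G S v + adjIn G B := by
      rw [← adjIn_union hdisj, hunion]
    have hcard : (#A : ℝ) = #S + #B := by
      rw [← hunion, card_union_of_disjoint hdisj]; push_cast; rfl
    have hcast : ((p + 1 : ℕ) : ℝ) + 1 = p + 2 := by push_cast; ring
    rw [hcast, hcard]
    by_cases hcol : ∃ c : V → Fin (p + 1), ∀ v ∈ S, ∀ w ∈ S, G.Adj v w → c v ≠ c w
    · obtain ⟨c, hcS⟩ := hcol
      obtain ⟨y, hy, z, hz, hyz⟩ : ∃ y ∈ B, ∃ z ∈ B, G.Adj y z := by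
        by_contra! hcon
        refine hc ⟨fun v => if v ∈ S then (c v).castSucc else Fin.last _, fun v hv w hw hvw => ?_⟩
        rw [← hunion, mem_union] at hv hw
        by_cases hvS : v ∈ S <;> by_cases hwS : w ∈ S
        · simpa [hvS, hwS] using hcS v hvS w hwS hvw
        · simp [hvS, hwS]
        · simpa [hvS, hwS] using (Fin.castSucc_ne_last _).symm
        · exact absurd hvw (hcon v (by tauto) w (by tauto))
      set N := {v ∈ S | G.Adj y v ∧ G.Adj z v} with hN
      have hNS : N ⊆ S := filter_subset _ _
      have hfib : ∀ T ⊆ S, #T = ∑ i, #{v ∈ T | c v = i} := fun T _ =>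
        card_eq_sum_card_fiberwise (by simp)
      -- Otherwise the common neighbourhood `N` of `y` and `z` keeps enough of each class for a full
      -- transversal, which together with `y` and `z` is a forbidden clique.
      have hi : ∃ i, 2 * #{v ∈ S | c v = i} + 2 * #N ≤ #(crossNonadj G S c) + 2 * #S := by
        by_contra! hcon
        obtain ⟨w, hw⟩ := exists_full_transversal (G := G) (c := c) hNS (fun i => by
          have h1 := hcon i
          have h2 : #{v ∈ S | c v = i} + #N ≤ #{v ∈ N | c v = i} + #S := by
            rw [hfib N hNS, hfib S subset_rfl, ← add_sum_erase _ _ (mem_univ i),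
              ← add_sum_erase univ (fun i => #{v ∈ S | c v = i}) (mem_univ i)]
            have : ∑ j ∈ univ.erase i, #{v ∈ N | c v = j} ≤
                ∑ j ∈ univ.erase i, #{v ∈ S | c v = j} :=
              sum_le_sum fun j _ => card_le_card (filter_subset_filter _ hNS)
            omega
          omega)
        have hwN : ∀ i, w i ∈ S ∧ G.Adj y (w i) ∧ G.Adj z (w i) := fun i =>
          mem_filter.1 (hw i).1
        refine hA (Fin.cons y (Fin.cons z w)) ?_ (pairwise_adj_cons (pairwise_adj_cons ?_ ?_) ?_)
        · refine Fin.cases ?_ (Fin.cases ?_ fun i => ?_)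
          · simpa using hBA hy
          · simpa using hBA hz
          · simpa using hSA (hwN i).1
        · intro i j hij
          exact (hw i).2.2 _ (hwN j).1 (by rw [(hw j).2.1]; exact hij.symm)
        · exact fun i => (hwN i).2.2
        · refine Fin.cases ?_ fun i => ?_
          · simpa using hyz
          · simpa using (hwN i).2.1
      obtain ⟨i, hi⟩ := hi
      have h1 := adjIn_add_sum_sq_add_crossNonadj hcS
      have h2 := two_mul_degIn_add_degIn_le_adjIn hy hz hyz
      have h3 : degIn G S y + degIn G S z ≤ #S + #N := by
        rw [degIn, degIn, ← card_union_add_card_inter, ← filter_and]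
        exact Nat.add_le_add_right (card_le_card (union_subset (filter_subset _ _)
          (filter_subset _ _))) _
      -- Every vertex of `B` except `y` and `z` has its degree bounded by the maximum degree `#S`;
      -- the degrees of `y` and `z` are kept exactly.
      have h4 : 2 * ∑ v ∈ B, degIn G S v + 2 * adjIn G B + 2 * (2 * #S) ≤
          2 * (#S * #B) + 2 * (degIn G S y + degIn G S z) + 2 * (degIn G B y + degIn G B z) := by
        have hzB : z ∈ B.erase y := mem_erase.2 ⟨hyz.ne.symm, hz⟩
        have e1 : ∑ v ∈ B, degIn G S v + adjIn G B = ∑ v ∈ B, (degIn G S v + degIn G B v) := by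
          rw [sum_add_distrib]; rfl
        have e2 : ∑ v ∈ (B.erase y).erase z, (degIn G S v + degIn G B v) ≤
            #((B.erase y).erase z) * #S := by
          rw [← smul_eq_mul]
          exact sum_le_card_nsmul _ _ _ fun v hv => hdeg v (mem_of_mem_erase (mem_of_mem_erase hv))
        have e3 : #((B.erase y).erase z) + 2 = #B := by
          rw [← card_erase_add_one hy, ← card_erase_add_one hzB]
        have e5 : ∑ v ∈ B, (degIn G S v + degIn G B v) = degIn G S y + degIn G B y +
            (degIn G S z + degIn G B z +
              ∑ v ∈ (B.erase y).erase z, (degIn G S v + degIn G B v)) := by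
          rw [← add_sum_erase _ _ hy, ← add_sum_erase _ _ hzB]
        have e4 : #((B.erase y).erase z) * #S + 2 * #S = #S * #B := by rw [← e3]; ring
        omega
      have h5 : (#S : ℝ) = ∑ j, (#{v ∈ S | c v = j} : ℝ) := by
        exact_mod_cast hfib S subset_rfl
      have h6 := sq_sum_bound (fun j => (#{v ∈ S | c v = j} : ℝ)) (#B : ℝ) i
      rw [← h5] at h6
      have h7 : adjIn G A + ∑ j, #{v ∈ S | c v = j} ^ 2 + 2 * #{v ∈ S | c v = i} ≤
          #S ^ 2 + 2 * (#S * #B) + 2 := by omega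
      have h8 : (adjIn G A : ℝ) + ∑ j, (#{v ∈ S | c v = j} : ℝ) ^ 2 + 2 * #{v ∈ S | c v = i} ≤
          (#S : ℝ) ^ 2 + 2 * (#S * #B) + 2 := by exact_mod_cast h7
      have h9 : 1 / ((p : ℝ) + 2) ≤ 1 := by
        rw [div_le_one (by positivity)]; linarith [(Nat.cast_nonneg p : (0 : ℝ) ≤ p)]
      linarith
    -- A clique in `S` extends by `x`, so induction applies to `S`; the edges meeting `B` are
    -- bounded through the maximum degree.
    · have h1 := ih S (fun w hw hadj => hA (Fin.cons x w)
        (Fin.cases (by simpa using hxA) fun i => by simpa using hSA (hw i))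
        (pairwise_adj_cons hadj fun i => (mem_filter.1 (hw i)).2)) hcol
      have h2 : 2 * ∑ v ∈ B, degIn G S v + adjIn G B ≤ 2 * (#S * #B) := by
        have e2 : ∑ v ∈ B, (degIn G S v + degIn G B v) ≤ #B * #S := by
          rw [← smul_eq_mul]
          exact sum_le_card_nsmul _ _ _ hdeg
        rw [sum_add_distrib, mul_comm] at e2
        have e3 : adjIn G B = ∑ v ∈ B, degIn G B v := rfl
        omega
      have h3 : (adjIn G A : ℝ) ≤ adjIn G S + 2 * (#S * #B) := by
        exact_mod_cast (by omega : adjIn G A ≤ adjIn G S + 2 * (#S * #B))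
      have h4 := max_degree_bound p (#S) (#B)
      linarith

end

/-! ### Degrees on cliques without a singular `K_{r+1}` -/

section

variable {V W : Type*} [Fintype V] [Fintype W] {G : SimpleGraph V} {H : SimpleGraph W}

lemma degree_eq_degIn_univ [DecidableRel G.Adj] (v : V) : G.degree v = degIn G univ v := by
  rw [← SimpleGraph.card_neighborFinset_eq_degree, SimpleGraph.neighborFinset_eq_filter, degIn]
  congr

lemma two_mul_numEdges (G : SimpleGraph V) : 2 * numEdges G = adjIn G univ := by
  rw [numEdges, ← SimpleGraph.sum_degrees_eq_twice_card_edges, adjIn]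
  exact sum_congr rfl fun v _ => by rw [degree_eq_degIn_univ]

lemma degIn_univ_iso (e : G ≃g H) (v : V) : degIn H univ (e v) = degIn G univ v := by
  refine (card_bij (fun a _ => e a) ?_ ?_ ?_).symm
  · intro a ha
    exact mem_filter.2 ⟨mem_univ _, e.map_adj_iff.2 (mem_filter.1 ha).2⟩
  · intro a _ b _ h; exact e.injective h
  · intro b hb; exact ⟨e.symm b, by
      have : H.Adj (e v) b := by simpa using hb
      rw [← e.apply_symm_apply b, e.map_adj_iff] at this
      simpa using this, by simp⟩

lemma numEdges_iso (e : G ≃g H) : numEdges G = numEdges H := by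
  have h1 := two_mul_numEdges G
  have h2 := two_mul_numEdges H
  have h3 : adjIn G univ = adjIn H univ :=
    Fintype.sum_equiv e.toEquiv _ _ fun v => (degIn_univ_iso e v).symm
  omega

lemma singularFree_completeGraph_iff {r : ℕ} :
    SingularFree (SimpleGraph.completeGraph (Fin (r + 1))) G ↔
      ∀ f : Fin (r + 1) → V, (∀ i j, i ≠ j → G.Adj (f i) (f j)) →
        ¬ ((∀ i j, degIn G univ (f i) = degIn G univ (f j)) ∨
          ∀ i j, i ≠ j → degIn G univ (f i) ≠ degIn G univ (f j)) := by
  simp only [SingularFree, IsSingularCopy, degree_eq_degIn_univ]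
  constructor
  · intro h f hf
    exact h ⟨⟨f, fun {a b} hab => hf a b (by simpa using hab)⟩, fun a b hab => by
      by_contra hne
      exact (hf a b hne).ne hab⟩
  · intro h f
    exact h f fun i j hij => f.toHom.map_adj (by simpa using hij)

lemma SingularFree.iso {r : ℕ} (e : G ≃g H)
    (h : SingularFree (SimpleGraph.completeGraph (Fin (r + 1))) G) :
    SingularFree (SimpleGraph.completeGraph (Fin (r + 1))) H := by
  rw [singularFree_completeGraph_iff] at h ⊢
  intro f hf
  have := h (e.symm ∘ f) fun i j hij =>
    e.symm.map_adj_iff.2 (hf i j hij)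
  simpa [← degIn_univ_iso e] using this

lemma exists_injective_of_lt_card {α : Type*} {r : ℕ} {s : Finset α} (h : r < #s) :
    ∃ f : Fin (r + 1) → α, Function.Injective f ∧ ∀ i, f i ∈ s := by
  obtain ⟨t, hts, ht⟩ := exists_subset_card_eq (Nat.succ_le_of_lt h)
  refine ⟨fun i => ((t.equivFinOfCardEq ht).symm i : α), ?_, fun i => hts (Subtype.prop _)⟩
  intro i j hij
  exact (t.equivFinOfCardEq ht).symm.injective (Subtype.ext hij)

lemma SingularFree.card_fiber_le {r k : ℕ} {w : Fin k → V}
    (h : SingularFree (SimpleGraph.completeGraph (Fin (r + 1))) G)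
    (hw : ∀ i j, i ≠ j → G.Adj (w i) (w j)) (x : ℕ) :
    #{i | degIn G univ (w i) = x} ≤ r := by
  rw [singularFree_completeGraph_iff] at h
  by_contra! hlt
  obtain ⟨f, hf, hmem⟩ := exists_injective_of_lt_card hlt
  refine h (w ∘ f) (fun i j hij => hw _ _ (hf.ne hij)) (Or.inl fun i j => ?_)
  exact (mem_filter.1 (hmem i)).2.trans (mem_filter.1 (hmem j)).2.symm

lemma SingularFree.card_image_le {r k : ℕ} {w : Fin k → V}
    (h : SingularFree (SimpleGraph.completeGraph (Fin (r + 1))) G)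
    (hw : ∀ i j, i ≠ j → G.Adj (w i) (w j)) :
    #(univ.image fun i => degIn G univ (w i)) ≤ r := by
  rw [singularFree_completeGraph_iff] at h
  by_contra! hlt
  obtain ⟨f, hf, hmem⟩ := exists_injective_of_lt_card hlt
  have : ∀ i, ∃ j, degIn G univ (w j) = f i := fun i => by simpa using hmem i
  choose g hg using this
  have hgi : Function.Injective g := fun i j hij => hf (by rw [← hg, ← hg, hij])
  refine h (w ∘ g) (fun i j hij => hw _ _ (hgi.ne hij)) (Or.inr fun i j hij => ?_)
  simpa [hg] using hf.ne hij

/-- A graph without a singular `K_{r+1}` has no clique on `r ^ 2 + 1` vertices. -/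
lemma SingularFree.not_clique {r k : ℕ} (hk : r ^ 2 < k) (w : Fin k → V)
    (h : SingularFree (SimpleGraph.completeGraph (Fin (r + 1))) G) :
    ¬ ∀ i j, i ≠ j → G.Adj (w i) (w j) := by
  intro hw
  have h1 := card_le_mul_card_image (s := univ) (f := fun i => degIn G univ (w i)) r
    fun x _ => h.card_fiber_le hw x
  have h2 := Nat.mul_le_mul_left r (h.card_image_le hw)
  rw [card_univ, Fintype.card_fin] at h1
  nlinarith

/-- At most `r` values, each taken at most `r` times, must cover `r ^ 2` indices, so neither bound
has slack. -/
lemma propertyR_of_card_le {r : ℕ} {s : Fin (r ^ 2) → ℕ} (h1 : ∀ x, #{i | s i = x} ≤ r)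
    (h2 : #(univ.image s) ≤ r) : PropertyR s := by
  have h3 : r * r = ∑ x ∈ univ.image s, #{i | s i = x} := by
    rw [← card_eq_sum_card_image, card_univ, Fintype.card_fin, sq]
  have h4 : #(univ.image s) = r := by
    have h5 : ∑ x ∈ univ.image s, #{i | s i = x} ≤ #(univ.image s) * r := by
      rw [← smul_eq_mul]
      exact sum_le_card_nsmul _ _ _ fun x _ => h1 x
    rw [← h3] at h5
    rcases Nat.eq_zero_or_pos r with rfl | hr
    · omega
    · exact le_antisymm h2 (Nat.le_of_mul_le_mul_right h5 hr)
  refine ⟨h4, (sum_eq_sum_iff_of_le fun x _ => h1 x).1 ?_⟩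
  rw [← h3, sum_const, h4, smul_eq_mul]

lemma SingularFree.propertyR {r : ℕ} {s : Fin (r ^ 2) → ℕ} {w : Fin (r ^ 2) → V}
    (h : SingularFree (SimpleGraph.completeGraph (Fin (r + 1))) G)
    (hw : ∀ i j, i ≠ j → G.Adj (w i) (w j))
    (hs : ∀ i, degIn G univ (w i) + s i = Fintype.card V) : PropertyR s := by
  refine propertyR_of_card_le (fun x => ?_) ?_
  · refine (card_le_card fun i hi => ?_).trans (h.card_fiber_le hw (Fintype.card V - x))
    have := hs i
    simp only [mem_filter, mem_univ, true_and] at hi ⊢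
    omega
  · refine le_trans ?_ (h.card_image_le hw)
    have : univ.image s = (univ.image fun i => degIn G univ (w i)).image
        fun d => Fintype.card V - d := by
      rw [image_image]
      congr 1
      ext i
      have := hs i
      simp only [Function.comp]
      omega
    rw [this]
    exact Finset.card_image_le

end

/-! ### Complete multipartite graphs and their part sizes -/

section

variable {V W : Type*} [Fintype V] {G : SimpleGraph V} {H : SimpleGraph W} {q r : ℕ}

lemma isCompletePartite_iff {s : Fin q → ℕ} :
    IsCompletePartite s G ↔ (∀ i, 0 < s i) ∧ ∃ c : V → Fin q,
      (∀ v w, G.Adj v w ↔ c v ≠ c w) ∧ ∀ i, #{v | c v = i} = s i := by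
  refine and_congr_right fun _ => ⟨?_, ?_⟩
  · rintro ⟨e⟩
    refine ⟨fun v => (e v).1, fun v w => ?_, fun i => ?_⟩
    · rw [← e.map_adj_iff]; simp
    · rw [← Fintype.card_fin (s i), ← card_univ, eq_comm]
      refine card_bij (fun x _ => e.symm ⟨i, x⟩) ?_ ?_ ?_
      · intro x _; simp
      · intro x _ y _ hxy; simpa using hxy
      · intro v hv
        obtain rfl : (e v).1 = i := by simpa using hv
        exact ⟨(e v).2, mem_univ _, by simp⟩
  · rintro ⟨c, hc, hs⟩
    have e : ∀ i, Nonempty ({v // c v = i} ≃ Fin (s i)) := fun i =>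
      ⟨Fintype.equivFinOfCardEq (by rw [Fintype.card_subtype, hs])⟩
    refine ⟨⟨(Equiv.sigmaFiberEquiv c).symm.trans
      (Equiv.sigmaCongrRight fun i => (e i).some), fun {a b} => ?_⟩⟩
    rw [hc]
    rfl

lemma adjIn_univ_of_complete {c : V → Fin q} (hc : ∀ v w, G.Adj v w ↔ c v ≠ c w) :
    adjIn G univ + ∑ i, #{v | c v = i} ^ 2 = Fintype.card V ^ 2 := by
  have h := adjIn_add_sum_sq_add_crossNonadj (G := G) (A := univ) (c := c)
    fun v _ w _ h => (hc v w).1 h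
  have h0 : crossNonadj G univ c = ∅ := by
    ext p; simp [crossNonadj, hc]
  rw [h0] at h
  simpa using h

lemma sum_card_fiber (c : V → Fin q) : ∑ i, #{v | c v = i} = Fintype.card V := by
  rw [← card_eq_sum_card_fiberwise (by simp), card_univ]

lemma degIn_add_card_fiber {c : V → Fin q} {v : V} (hc : ∀ w, G.Adj v w ↔ c w ≠ c v) :
    degIn G univ v + #{w | c w = c v} = Fintype.card V := by
  have := card_filter_add_card_filter_not (s := (univ : Finset V)) (fun w => c w = c v)
  rw [card_univ] at this
  simp only [degIn, hc, ne_eq]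
  omega

lemma IsCompletePartite.two_mul_numEdges {s : Fin q → ℕ} (h : IsCompletePartite s G) :
    2 * numEdges G + ∑ i, s i ^ 2 = Fintype.card V ^ 2 := by
  obtain ⟨_, c, hc, hs⟩ := isCompletePartite_iff.1 h
  rw [SingularTuran.two_mul_numEdges, ← adjIn_univ_of_complete hc]
  simp only [hs]

lemma IsCompletePartite.sum_eq {s : Fin q → ℕ} (h : IsCompletePartite s G) :
    ∑ i, s i = Fintype.card V := by
  obtain ⟨_, c, hc, hs⟩ := isCompletePartite_iff.1 h
  rw [← sum_card_fiber c]
  simp only [hs]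

/-- A clique meets each part at most once and degrees are determined by part sizes. So equal degrees
would need `r + 1` parts of one size, and distinct degrees `r + 1` sizes. -/
lemma IsCompletePartite.singularFree {s : Fin (r ^ 2) → ℕ} (h : IsCompletePartite s G)
    (hR : PropertyR s) : SingularFree (SimpleGraph.completeGraph (Fin (r + 1))) G := by
  obtain ⟨hpos, c, hc, hs⟩ := isCompletePartite_iff.1 h
  rw [singularFree_completeGraph_iff]
  have hdeg : ∀ v, degIn G univ v + s (c v) = Fintype.card V := fun v => by
    rw [← hs, degIn_add_card_fiber (G := G) (c := c) (v := v) (fun u => by rw [hc]; exact ne_comm)]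
  intro f hf
  have hcf : Function.Injective (c ∘ f) := fun i j hij => by
    by_contra hne
    exact (hc _ _).1 (hf i j hne) hij
  rintro (hsame | hdiff)
  · have h1 := hR.2 (s (c (f 0))) (by simp)
    have h2 : #(univ.image (c ∘ f)) ≤ #{i | s i = s (c (f 0))} := by
      refine card_le_card fun i hi => ?_
      obtain ⟨j, -, rfl⟩ := mem_image.1 hi
      have a1 := hdeg (f 0)
      have a2 := hdeg (f j)
      have a3 := hsame 0 j
      simp only [Function.comp, mem_filter, mem_univ, true_and]
      omega
    rw [card_image_of_injective _ hcf, card_univ, Fintype.card_fin, h1] at h2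
    omega
  · have h2 : #(univ.image (s ∘ c ∘ f)) ≤ #(univ.image s) := by
      refine card_le_card fun x hx => ?_
      obtain ⟨j, -, rfl⟩ := mem_image.1 hx
      simp
    rw [card_image_of_injective, card_univ, Fintype.card_fin, hR.1] at h2
    · omega
    · intro i j hij
      by_contra hne
      have a1 := hdeg (f i)
      have a2 := hdeg (f j)
      simp only [Function.comp] at hij
      exact hdiff i j hne (by omega)

lemma IsCompletePartite.nonempty_iso {s t : Fin (r ^ 2) → ℕ} (hG : IsCompletePartite s G)
    (hH : IsCompletePartite t H) (hs : PropertyR s) (ht : PropertyR t)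
    (himage : univ.image s = univ.image t) : Nonempty (G ≃g H) := by
  have hfib : ∀ x, #{i | s i = x} = #{i | t i = x} := by
    intro x
    by_cases hx : x ∈ univ.image s
    · rw [hs.2 x hx, ht.2 x (himage ▸ hx)]
    · have hx' : x ∉ univ.image t := himage ▸ hx
      simp only [mem_image, mem_univ, true_and, not_exists] at hx hx'
      simp [hx, hx']
  have e : ∀ x, Nonempty ({i // s i = x} ≃ {i // t i = x}) := fun x =>
    ⟨Fintype.equivOfCardEq (by rw [Fintype.card_subtype, Fintype.card_subtype, hfib])⟩
  set σ := Equiv.ofFiberEquiv fun x => (e x).some with hσ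
  have hst : ∀ i, t (σ i) = s i := Equiv.ofFiberEquiv_map _
  obtain ⟨_, c, hc, hcs⟩ := isCompletePartite_iff.1 hG
  have hG' : IsCompletePartite t G := by
    refine isCompletePartite_iff.2 ⟨hH.1, σ ∘ c, fun v w => ?_, fun i => ?_⟩
    · simp [hc]
    · rw [← σ.apply_symm_apply i, hst, ← hcs]
      simp only [Function.comp, σ.apply_symm_apply, ← Equiv.eq_symm_apply]
  exact ⟨hG'.2.some.trans hH.2.some.symm⟩

lemma exists_isCompletePartite {n : ℕ} {s : Fin q → ℕ} (hpos : ∀ i, 0 < s i)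
    (hs : ∑ i, s i = n) : ∃ G : SimpleGraph (Fin n), IsCompletePartite s G := by
  have e : (Σ i, Fin (s i)) ≃ Fin n := Fintype.equivFinOfCardEq (by simp [hs])
  exact ⟨(SimpleGraph.completeMultipartiteGraph fun i => Fin (s i)).map e.toEmbedding, hpos,
    ⟨(SimpleGraph.Iso.map e _).symm⟩⟩

/-- Reduces vertex and edge counts to sums over the `r`-element set of sizes. -/
lemma PropertyR.sum_comp {M : Type*} [AddCommMonoid M] {s : Fin (r ^ 2) → ℕ} (h : PropertyR s)
    (f : ℕ → M) : ∑ i, f (s i) = r • ∑ x ∈ univ.image s, f x := by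
  rw [Finset.sum_comp, smul_sum]
  exact sum_congr rfl fun x hx => by rw [h.2 x hx]

lemma exists_propertyR {T : Finset ℕ} (hT : #T = r) :
    ∃ s : Fin (r ^ 2) → ℕ, PropertyR s ∧ univ.image s = T := by
  have e : Fin (r ^ 2) ≃ Fin r × Fin r := Fintype.equivOfCardEq (by simp [sq])
  set g := (T.equivFinOfCardEq hT).symm
  have himage : univ.image (fun i => (g (e i).1 : ℕ)) = T := by
    ext x
    simp only [mem_image, mem_univ, true_and]
    constructor
    · rintro ⟨i, rfl⟩; exact Subtype.prop _
    · intro hx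
      exact ⟨e.symm (g.symm ⟨x, hx⟩, g.symm ⟨x, hx⟩), by simp⟩
  refine ⟨fun i => (g (e i).1 : ℕ), ⟨by rw [himage, hT], fun x hx => ?_⟩, himage⟩
  rw [himage] at hx
  refine Eq.trans (Eq.symm ?_) (card_fin r)
  refine card_bij (fun j _ => e.symm (g.symm ⟨x, hx⟩, j)) ?_ ?_ ?_
  · intro j _; simp
  · intro i _ j _ hij; simpa using hij
  · intro i hi
    have : (g (e i).1 : ℕ) = x := by simpa using hi
    refine ⟨(e i).2, mem_univ _, ?_⟩
    rw [Equiv.symm_apply_eq]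
    have h2 : g.symm ⟨x, hx⟩ = (e i).1 := by rw [Equiv.symm_apply_eq]; exact Subtype.ext this.symm
    rw [h2]

end

end SingularTuran

/-! ### Sets of `r` naturals with given sum and least sum of squares -/

namespace SingularTuran

open Finset

lemma sum_Icc_add (a r : ℕ) :
    ∑ x ∈ Icc a (a + r), x = (r + 1) * a + ∑ i ∈ range r, i + r := by
  induction r with
  | zero => simp
  | succ r ih =>
    rw [← add_assoc, sum_Icc_succ_top (by omega), ih, sum_range_succ]
    ring

/-- The interval of length `r` above the minimum has `r + 1` elements, so exactly one is missing. -/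
lemma exists_eq_Icc_erase {r : ℕ} {S : Finset ℕ} (hr : 0 < r) (hS : #S = r)
    (hb : ∀ x ∈ S, ∀ y ∈ S, y ≤ x + r) :
    ∃ a x, a ≤ x ∧ x ≤ a + r ∧ S = (Icc a (a + r)).erase x := by
  have hne : S.Nonempty := card_pos.1 (by omega)
  set a := S.min' hne
  have hsub : S ⊆ Icc a (a + r) := fun y hy =>
    mem_Icc.2 ⟨S.min'_le y hy, hb _ (S.min'_mem hne) y hy⟩
  have hcard : #(Icc a (a + r) \ S) = 1 := by
    rw [card_sdiff_of_subset hsub, Nat.card_Icc]; omega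
  obtain ⟨x, hx⟩ := card_eq_one.1 hcard
  have hxm : x ∈ Icc a (a + r) \ S := by rw [hx]; simp
  obtain ⟨h1, h2⟩ := mem_sdiff.1 hxm
  refine ⟨a, x, (mem_Icc.1 h1).1, (mem_Icc.1 h1).2, ?_⟩
  rw [erase_eq, ← hx, Finset.sdiff_sdiff_eq_self hsub]

lemma sum_Icc_erase {a r x : ℕ} (h1 : a ≤ x) (h2 : x ≤ a + r) :
    ∑ y ∈ (Icc a (a + r)).erase x, y + x = (r + 1) * a + ∑ i ∈ range r, i + r := by
  rw [sum_erase_add _ _ (mem_Icc.2 ⟨h1, h2⟩), sum_Icc_add]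

/-- The hypothesis `h` says that the two punctured intervals have equal sums. For `r > 0` this
forces `b = a + 1`, `x = a` and `y = b + r`: one interval with its end removed, described twice. -/
lemma Icc_erase_eq_of_lt {a b x y r : ℕ} (hx : a ≤ x) (hy : y ≤ b + r) (hab : a < b)
    (h : (r + 1) * a + y = (r + 1) * b + x) :
    (Icc a (a + r)).erase x = (Icc b (b + r)).erase y := by
  obtain ⟨k, rfl⟩ := Nat.exists_eq_add_of_lt hab
  have hk : k = 0 ∨ r = 0 := by
    by_contra! hcon
    have h1 : 1 ≤ k := Nat.one_le_iff_ne_zero.2 hcon.1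
    have h2 : 1 ≤ r := Nat.one_le_iff_ne_zero.2 hcon.2
    nlinarith
  rcases hk with rfl | rfl
  · have e : (r + 1) * (a + 0 + 1) = (r + 1) * a + (r + 1) := by ring
    ext z
    simp only [mem_erase, mem_Icc]
    omega
  · ext z
    simp only [mem_erase, mem_Icc]
    omega

/-- A set of `r` natural numbers of diameter at most `r` is determined by its sum. -/
lemma eq_of_sum_eq_of_balanced {r : ℕ} {S T : Finset ℕ} (hS : #S = r) (hT : #T = r)
    (hbS : ∀ x ∈ S, ∀ y ∈ S, y ≤ x + r) (hbT : ∀ x ∈ T, ∀ y ∈ T, y ≤ x + r)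
    (h : ∑ x ∈ S, x = ∑ x ∈ T, x) : S = T := by
  rcases Nat.eq_zero_or_pos r with rfl | hr
  · rw [card_eq_zero.1 hS, card_eq_zero.1 hT]
  obtain ⟨a, x, hx1, hx2, rfl⟩ := exists_eq_Icc_erase hr hS hbS
  obtain ⟨b, y, hy1, hy2, rfl⟩ := exists_eq_Icc_erase hr hT hbT
  have h1 := sum_Icc_erase hx1 hx2
  have h2 := sum_Icc_erase hy1 hy2
  rcases lt_trichotomy a b with hab | rfl | hab
  · exact Icc_erase_eq_of_lt hx1 hy2 hab (by omega)
  · obtain rfl : x = y := by omega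
    rfl
  · exact (Icc_erase_eq_of_lt hy1 hx2 hab (by omega)).symm

/-- A spread above `r` leaves at least two gaps between `x` and `y`. Moving the element just below
the lowest gap up by one, and the element just above the highest gap down by one, keeps the sum and
lowers the squares. -/
lemma exists_sum_sq_lt {r : ℕ} {S : Finset ℕ} (hS : #S = r) {x y : ℕ} (hx : x ∈ S) (hy : y ∈ S)
    (hxy : x + r < y) :
    ∃ T : Finset ℕ, #T = r ∧ ∑ z ∈ T, z = ∑ z ∈ S, z ∧ ∑ z ∈ T, z ^ 2 < ∑ z ∈ S, z ^ 2 := by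
  set M := Icc x y \ S with hM
  have hcard : 1 < #M := by
    have := le_card_sdiff S (Icc x y)
    rw [Nat.card_Icc, ← hM] at this
    omega
  have hne : M.Nonempty := card_pos.1 (by omega)
  obtain ⟨hg1, hgS⟩ := mem_sdiff.1 (M.min'_mem hne)
  obtain ⟨hh1, hhS⟩ := mem_sdiff.1 (M.max'_mem hne)
  have hlt := M.min'_lt_max'_of_card hcard
  have hmin : ∀ z ∈ M, M.min' hne ≤ z := fun z hz => M.min'_le z hz
  have hmax : ∀ z ∈ M, z ≤ M.max' hne := fun z hz => M.le_max' z hz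
  generalize M.min' hne = g at *
  generalize M.max' hne = h at *
  rw [mem_Icc] at hg1 hh1
  have hxg : x < g := lt_of_le_of_ne hg1.1 fun e => hgS (e ▸ hx)
  have hhy : h < y := lt_of_le_of_ne hh1.2 fun e => hhS (e ▸ hy)
  obtain ⟨u, rfl⟩ : ∃ u, g = u + 1 := ⟨g - 1, by omega⟩
  have hu : u ∈ S := by
    by_contra hu
    have := hmin u (mem_sdiff.2 ⟨mem_Icc.2 ⟨by omega, by omega⟩, hu⟩)
    omega
  have hv : h + 1 ∈ S := by
    by_contra hu
    have := hmax (h + 1) (mem_sdiff.2 ⟨mem_Icc.2 ⟨by omega, by omega⟩, hu⟩)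
    omega
  have hv' : h + 1 ∈ S.erase u := mem_erase.2 ⟨by omega, hv⟩
  set R := (S.erase u).erase (h + 1) with hR
  have hgR : u + 1 ∉ R := fun hm => hgS (mem_of_mem_erase (mem_of_mem_erase hm))
  have hhR : h ∉ insert (u + 1) R := by
    rw [mem_insert]
    rintro (e | hm)
    · omega
    · exact hhS (mem_of_mem_erase (mem_of_mem_erase hm))
  have hsum : ∀ f : ℕ → ℕ, ∑ z ∈ insert h (insert (u + 1) R), f z + f u + f (h + 1) =
      ∑ z ∈ S, f z + f (u + 1) + f h := by
    intro f
    rw [sum_insert hhR, sum_insert hgR, ← add_sum_erase S f hu, ← add_sum_erase _ f hv']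
    ring
  refine ⟨insert h (insert (u + 1) R), ?_, ?_, ?_⟩
  · rw [card_insert_of_notMem hhR, card_insert_of_notMem hgR, card_erase_add_one hv',
      card_erase_add_one hu, hS]
  · have := hsum fun z => z
    omega
  · have := hsum fun z => z ^ 2
    nlinarith

/-- Among the sets of `r` natural numbers with a given sum, the one of diameter at most `r` is the
only one with the least sum of squares. -/
lemma sum_sq_le_of_balanced {r : ℕ} {B : Finset ℕ} (hB : #B = r)
    (hb : ∀ x ∈ B, ∀ y ∈ B, y ≤ x + r) (S : Finset ℕ) (hS : #S = r)
    (h : ∑ x ∈ S, x = ∑ x ∈ B, x) :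
    ∑ x ∈ B, x ^ 2 ≤ ∑ x ∈ S, x ^ 2 ∧ (∑ x ∈ S, x ^ 2 ≤ ∑ x ∈ B, x ^ 2 → S = B) := by
  induction hk : ∑ x ∈ S, x ^ 2 using Nat.strong_induction_on generalizing S with
  | _ k ih =>
    by_cases hbS : ∀ x ∈ S, ∀ y ∈ S, y ≤ x + r
    · obtain rfl := eq_of_sum_eq_of_balanced hS hB hbS hb h
      exact ⟨hk.le, fun _ => rfl⟩
    · push Not at hbS
      obtain ⟨x, hx, y, hy, hxy⟩ := hbS
      obtain ⟨T, hT, hsum, hsq⟩ := exists_sum_sq_lt hS hx hy hxy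
      have := (ih _ (hk ▸ hsq) T hT (hsum.trans h) rfl).1
      exact ⟨by omega, fun _ => by omega⟩

lemma exists_balanced {r M : ℕ} (hr : 0 < r) (hM : ∑ i ∈ range r, i + r ≤ M) :
    ∃ B : Finset ℕ, #B = r ∧ ∑ x ∈ B, x = M ∧ (∀ x ∈ B, ∀ y ∈ B, y ≤ x + r) ∧
      ∀ x ∈ B, 0 < x := by
  set C := ∑ i ∈ range r, i
  set a := (M - C) / r with ha
  have hdiv := Nat.div_add_mod (M - C) r
  have hmod := Nat.mod_lt (M - C) hr
  have ha1 : 1 ≤ a := by rw [ha, Nat.le_div_iff_mul_le hr]; omega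
  rw [← ha] at hdiv
  -- Removing this point makes the sum `C + r * a + (M - C) % r = M`.
  have hmem : a + (r - (M - C) % r) ∈ Icc a (a + r) := mem_Icc.2 ⟨by omega, by omega⟩
  refine ⟨(Icc a (a + r)).erase (a + (r - (M - C) % r)), ?_, ?_, ?_, ?_⟩
  · rw [card_erase_of_mem hmem, Nat.card_Icc]; omega
  · have := sum_Icc_erase (a := a) (r := r) (x := a + (r - (M - C) % r)) (by omega) (by omega)
    rw [add_mul] at this
    omega
  · intro x hx y hy
    have h1 := mem_Icc.1 (mem_of_mem_erase hx)
    have h2 := mem_Icc.1 (mem_of_mem_erase hy)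
    omega
  · intro x hx
    have h1 := mem_Icc.1 (mem_of_mem_erase hx)
    omega

end SingularTuran

/-! ### Estimates for balanced sets and Turán numbers -/

namespace SingularTuran

open Finset
open scoped Classical

lemma abs_sub_mean_le_of_balanced {r : ℕ} {B : Finset ℕ} (hr : 0 < r) (hB : #B = r)
    (hb : ∀ x ∈ B, ∀ y ∈ B, y ≤ x + r) {x : ℕ} (hx : x ∈ B) :
    |(x : ℝ) - (∑ y ∈ B, (y : ℝ)) / r| ≤ r := by
  have hr' : (0 : ℝ) < r := by exact_mod_cast hr
  have h1 : (r : ℝ) * x - ∑ y ∈ B, (y : ℝ) = ∑ y ∈ B, ((x : ℝ) - y) := by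
    rw [sum_sub_distrib, sum_const, hB, nsmul_eq_mul]
  have h2 : |∑ y ∈ B, ((x : ℝ) - y)| ≤ r * r := by
    refine (abs_sum_le_sum_abs _ _).trans ?_
    refine (sum_le_card_nsmul B _ (r : ℝ) fun y hy => ?_).trans_eq (by rw [hB, nsmul_eq_mul])
    have h3 : (y : ℝ) ≤ x + r := by exact_mod_cast hb x hx y hy
    have h4 : (x : ℝ) ≤ y + r := by exact_mod_cast hb y hy x hx
    rw [abs_le]
    constructor <;> linarith
  rw [← h1, abs_le] at h2
  rw [abs_le]
  constructor
  · rw [le_sub_iff_add_le, ← le_sub_iff_add_le', div_le_iff₀ hr']; nlinarith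
  · rw [sub_le_iff_le_add, ← sub_le_iff_le_add', le_div_iff₀ hr']; nlinarith

lemma sum_sq_le_of_diam {r : ℕ} {B : Finset ℕ} (hr : 0 < r) (hB : #B = r)
    (hb : ∀ x ∈ B, ∀ y ∈ B, y ≤ x + r) :
    ∑ x ∈ B, (x : ℝ) ^ 2 ≤ (∑ x ∈ B, (x : ℝ)) ^ 2 / r + (r : ℝ) ^ 3 := by
  have hr' : (r : ℝ) ≠ 0 := by positivity
  set S := ∑ y ∈ B, (y : ℝ) with hS
  have h1 : ∑ x ∈ B, ((x : ℝ) - S / r) ^ 2 = ∑ x ∈ B, (x : ℝ) ^ 2 - S ^ 2 / r := by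
    simp only [sub_sq, sum_add_distrib, sum_sub_distrib, ← sum_mul, ← mul_sum, ← hS, sum_const,
      hB, nsmul_eq_mul]
    field_simp
    ring
  have h2 : ∑ x ∈ B, ((x : ℝ) - S / r) ^ 2 ≤ r * (r : ℝ) ^ 2 := by
    refine (sum_le_card_nsmul B _ ((r : ℝ) ^ 2) fun y hy => ?_).trans_eq (by rw [hB, nsmul_eq_mul])
    exact sq_le_sq' (abs_le.1 (abs_sub_mean_le_of_balanced hr hB hb hy)).1
      (abs_le.1 (abs_sub_mean_le_of_balanced hr hB hb hy)).2
  nlinarith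

section Turan

variable {q : ℕ}

lemma turanEdges_eq (n q : ℕ) :
    turanEdges n q = (n ^ 2 - (n % q) ^ 2) * (q - 1) / (2 * q) + (n % q).choose 2 := by
  rw [← SimpleGraph.card_edgeFinset_turanGraph, turanEdges, numEdges]
  congr!

/-- With `m = n % q`, the exact deficit is `m * (q - m) / q ≤ q / 4`; the extra `2` covers the
rounding in the natural-number division. -/
lemma two_mul_turanEdges_bounds (n : ℕ) (hq : 0 < q) :
    (1 - 1 / (q : ℝ)) * (n : ℝ) ^ 2 - q / 4 - 2 ≤ 2 * (turanEdges n q : ℝ) ∧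
      2 * (turanEdges n q : ℝ) ≤ (1 - 1 / (q : ℝ)) * (n : ℝ) ^ 2 := by
  have hq' : (0 : ℝ) < q := by exact_mod_cast hq
  have hq1 : (1 : ℝ) ≤ q := by exact_mod_cast hq
  have hmn : n % q ≤ n := Nat.mod_le _ _
  have hmq : (n % q : ℕ) < q := Nat.mod_lt _ hq
  rw [turanEdges_eq]
  generalize n % q = m at *
  set F := (n ^ 2 - m ^ 2) * (q - 1) / (2 * q) with hF
  have h1 : 2 * q * F ≤ (n ^ 2 - m ^ 2) * (q - 1) := Nat.mul_div_le _ _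
  have h2 : (n ^ 2 - m ^ 2) * (q - 1) < 2 * q * F + 2 * q := by
    have := Nat.lt_mul_div_succ ((n ^ 2 - m ^ 2) * (q - 1)) (by omega : 0 < 2 * q)
    rw [← hF] at this
    linarith
  have hsq : m ^ 2 ≤ n ^ 2 := Nat.pow_le_pow_left hmn 2
  have h1' : 2 * (q : ℝ) * F ≤ ((n : ℝ) ^ 2 - (m : ℝ) ^ 2) * (q - 1) := by
    have : ((2 * q * F : ℕ) : ℝ) ≤ (((n ^ 2 - m ^ 2) * (q - 1) : ℕ) : ℝ) := by exact_mod_cast h1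
    rw [Nat.cast_mul, Nat.cast_mul (n ^ 2 - m ^ 2), Nat.cast_sub hsq, Nat.cast_sub hq] at this
    push_cast at this
    exact this
  have h2' : ((n : ℝ) ^ 2 - (m : ℝ) ^ 2) * (q - 1) ≤ 2 * (q : ℝ) * F + 2 * q := by
    have : (((n ^ 2 - m ^ 2) * (q - 1) : ℕ) : ℝ) ≤ ((2 * q * F + 2 * q : ℕ) : ℝ) := by
      exact_mod_cast h2.le
    rw [Nat.cast_mul (n ^ 2 - m ^ 2), Nat.cast_sub hsq, Nat.cast_sub hq] at this
    push_cast at this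
    exact this
  have hm : (m : ℝ) ≤ q := by exact_mod_cast hmq.le
  have hm0 : (0 : ℝ) ≤ m := Nat.cast_nonneg m
  have e : (1 - 1 / (q : ℝ)) * (n : ℝ) ^ 2 = (n : ℝ) ^ 2 * (q - 1) / q := by field_simp
  rw [e, Nat.cast_add, Nat.cast_choose_two]
  constructor
  · rw [sub_sub, sub_le_iff_le_add, div_le_iff₀ hq']
    nlinarith [sq_nonneg ((q : ℝ) - 2 * m)]
  · rw [le_div_iff₀ hq']
    nlinarith [mul_nonneg hm0 (sub_nonneg.2 hm)]

end Turan

/-! ### Structure of dense graphs without a singular `K_{r+1}` -/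

section Upper

variable {V : Type*} [Fintype V] {G : SimpleGraph V} {r : ℕ}

lemma SingularFree.numEdges_le_turanEdges {n : ℕ} {G : SimpleGraph (Fin n)} (hr : 0 < r)
    (h : SingularFree (SimpleGraph.completeGraph (Fin (r + 1))) G) :
    numEdges G ≤ turanEdges n (r ^ 2) := by
  have hcf : G.CliqueFree (r ^ 2 + 1) := by
    rw [SimpleGraph.cliqueFree_iff]
    refine ⟨fun f => h.not_clique (Nat.lt_succ_self _) f fun i j hij => ?_⟩
    exact f.toHom.map_adj (by simpa using hij)
  have := (SimpleGraph.isTuranMaximal_turanGraph (n := n) (pow_pos hr 2)).2 hcf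
  rw [turanEdges, numEdges, numEdges]
  convert this

/-- A dense graph without a singular `K_{r+1}` is `r ^ 2`-partite, with `r` part sizes, each of
which occurs `r` times. -/
lemma SingularFree.exists_coloring (hr : 0 < r)
    (h : SingularFree (SimpleGraph.completeGraph (Fin (r + 1))) G)
    (he : (1 - 1 / (r : ℝ) ^ 2) * (Fintype.card V : ℝ) ^ 2 - 2 * (Fintype.card V : ℝ) / (r : ℝ) ^ 2
      + 4 < 2 * (numEdges G : ℝ)) :
    ∃ c : V → Fin (r ^ 2), (∀ v w, G.Adj v w → c v ≠ c w) ∧ (∀ i, 0 < #{v | c v = i}) ∧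
      PropertyR fun i => #{v | c v = i} := by
  have hq0 : (0 : ℝ) < (r : ℝ) ^ 2 := by positivity
  have he2 : 2 * (numEdges G : ℝ) = adjIn G univ := by exact_mod_cast two_mul_numEdges G
  rw [he2] at he
  set n : ℝ := (Fintype.card V : ℝ) with hn
  obtain ⟨c, hc⟩ : ∃ c : V → Fin (r ^ 2), ∀ v w, G.Adj v w → c v ≠ c w := by
    obtain ⟨p, hp⟩ : ∃ p, r ^ 2 = p + 1 := Nat.exists_eq_succ_of_ne_zero (pow_pos hr 2).ne'
    by_contra hcon
    have h1 := adjIn_le_of_not_colorable (G := G) p univ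
      (fun w _ => h.not_clique (by omega) w) (by
        rw [← hp]
        simpa using hcon)
    have hp' : (p : ℝ) + 1 = (r : ℝ) ^ 2 := by exact_mod_cast hp.symm
    rw [hp', card_univ, ← hn] at h1
    have : 0 ≤ 1 / (r : ℝ) ^ 2 := by positivity
    linarith
  have h1 := adjIn_add_sum_sq_add_crossNonadj (G := G) (A := univ) (c := c)
    fun v _ w _ => hc v w
  rw [card_univ] at h1
  have h1' : (adjIn G univ : ℝ) + ∑ i, (#{v | c v = i} : ℝ) ^ 2 + #(crossNonadj G univ c) =
      n ^ 2 := by rw [hn]; exact_mod_cast h1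
  have h2 : ∑ i, (#{v | c v = i} : ℝ) = n := by rw [hn]; exact_mod_cast sum_card_fiber c
  have h3 : ∑ i, ((#{v | c v = i} : ℝ) - n / (r : ℝ) ^ 2) ^ 2 =
      ∑ i, (#{v | c v = i} : ℝ) ^ 2 - n ^ 2 / (r : ℝ) ^ 2 := by
    simp only [sub_sq, sum_add_distrib, sum_sub_distrib, ← sum_mul, ← mul_sum, h2, sum_const,
      card_univ, Fintype.card_fin, nsmul_eq_mul]
    push_cast
    field_simp
    ring
  -- By `he`, the cross nonadjacencies plus the squared deviations of the class sizes from `n / r ^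
  -- 2` stay below `2 * n / r ^ 2 - 4`. A class well below the mean would already use up this
  -- budget.
  have h4 : ∀ i, #(crossNonadj G univ c) < 2 * #{v | c v = i} := by
    intro i
    have h5 : ((#{v | c v = i} : ℝ) - n / (r : ℝ) ^ 2) ^ 2 ≤ _ :=
      single_le_sum (f := fun i => ((#{v | c v = i} : ℝ) - n / (r : ℝ) ^ 2) ^ 2)
        (fun _ _ => sq_nonneg _) (mem_univ i)
    rw [h3] at h5
    have e1 : (1 - 1 / (r : ℝ) ^ 2) * n ^ 2 = n ^ 2 - n ^ 2 / (r : ℝ) ^ 2 := by ring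
    have e2 : 2 * n / (r : ℝ) ^ 2 = 2 * (n / (r : ℝ) ^ 2) := by ring
    rw [e1, e2] at he
    have : (#(crossNonadj G univ c) : ℝ) < 2 * #{v | c v = i} := by
      nlinarith [sq_nonneg ((#{v | c v = i} : ℝ) - n / (r : ℝ) ^ 2 + 1)]
    exact_mod_cast this
  obtain ⟨w, hw⟩ := exists_full_transversal (subset_refl _) h4
  refine ⟨c, hc, fun i => ?_, ?_⟩
  · have := h4 i
    omega
  -- The transversal is a clique, and each of its vertices misses exactly its own class.
  · refine h.propertyR (w := w) (fun i j hij => (hw i).2.2 _ (mem_univ _) ?_) fun i => ?_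
    · rw [(hw j).2.1]; exact hij.symm
    · rw [← degIn_add_card_fiber (G := G) (c := c) (v := w i), (hw i).2.1]
      intro u
      exact ⟨fun hu => (hc _ _ hu).symm, fun hu => (hw i).2.2 u (mem_univ _) (by
        rwa [(hw i).2.1] at hu)⟩

lemma PropertyR.dvd_sum {s : Fin (r ^ 2) → ℕ} (h : PropertyR s) : r ∣ ∑ i, s i :=
  ⟨_, by simpa using h.sum_comp fun x => x⟩

/-- The complete multipartite graph whose part sizes are taken from a set `B` of diameter at most
`r` is the unique densest dense graph without a singular `K_{r+1}`. -/
lemma SingularFree.numEdges_le_of_balanced {W : Type*} [Fintype W] {G₀ : SimpleGraph W} {M : ℕ}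
    {s₀ : Fin (r ^ 2) → ℕ} (hr : 0 < r)
    (hG₀ : IsCompletePartite s₀ G₀) (hs₀ : PropertyR s₀) (hb : ∀ i j, s₀ j ≤ s₀ i + r)
    (hW : Fintype.card W = r * M) (hV : Fintype.card V = r * M)
    (hM : r ^ 6 + 4 * r ^ 2 < 2 * (r * M))
    (h : SingularFree (SimpleGraph.completeGraph (Fin (r + 1))) G) :
    numEdges G ≤ numEdges G₀ ∧ (numEdges G₀ ≤ numEdges G → Nonempty (G ≃g G₀)) := by
  by_cases hle : numEdges G₀ ≤ numEdges G
  swap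
  · exact ⟨by omega, fun h => absurd h hle⟩
  have hr0 : (0 : ℝ) < r := by exact_mod_cast hr
  set B := univ.image s₀ with hB
  have hBcard : #B = r := hs₀.1
  have hBb : ∀ x ∈ B, ∀ y ∈ B, y ≤ x + r := by
    intro x hx y hy
    obtain ⟨i, -, rfl⟩ := mem_image.1 hx
    obtain ⟨j, -, rfl⟩ := mem_image.1 hy
    exact hb i j
  have hBsum : ∑ x ∈ B, x = M := by
    have h1 := hs₀.sum_comp fun x => x
    rw [hG₀.sum_eq, hW, smul_eq_mul] at h1
    exact (Nat.eq_of_mul_eq_mul_left hr h1).symm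
  have hBsq := hs₀.sum_comp fun x => x ^ 2
  rw [← hB, smul_eq_mul] at hBsq
  have hE₀ := hG₀.two_mul_numEdges
  rw [hBsq, hW] at hE₀
  have hE₀' : 2 * (numEdges G₀ : ℝ) + r * ∑ x ∈ B, (x : ℝ) ^ 2 = ((r : ℝ) * M) ^ 2 := by
    exact_mod_cast hE₀
  have hsq := sum_sq_le_of_diam hr hBcard hBb
  have hBsum' : ∑ x ∈ B, (x : ℝ) = M := by rw [← hBsum, Nat.cast_sum]
  rw [hBsum'] at hsq
  -- `G₀` falls short of the Turán bound by at most `r ^ 4` in twice the edges, and `hM` makes the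
  -- linear slack exceed `r ^ 4 + 4`.
  have hdense : (1 - 1 / (r : ℝ) ^ 2) * (Fintype.card V : ℝ) ^ 2
      - 2 * (Fintype.card V : ℝ) / (r : ℝ) ^ 2 + 4 < 2 * (numEdges G : ℝ) := by
    have h1 : (numEdges G₀ : ℝ) ≤ numEdges G := by exact_mod_cast hle
    have h2 : (r : ℝ) ^ 6 + 4 * (r : ℝ) ^ 2 < 2 * (r * M) := by exact_mod_cast hM
    have h3 : (r : ℝ) * ∑ x ∈ B, (x : ℝ) ^ 2 ≤ M ^ 2 + (r : ℝ) ^ 4 := by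
      refine (mul_le_mul_of_nonneg_left hsq hr0.le).trans_eq ?_
      field_simp
    have h4 : (r : ℝ) ^ 4 + 4 < 2 * (r * M) / (r : ℝ) ^ 2 := by
      rw [lt_div_iff₀ (by positivity)]
      nlinarith
    have h5 : (1 - 1 / (r : ℝ) ^ 2) * ((r : ℝ) * M) ^ 2 = (r * M) ^ 2 - M ^ 2 := by
      field_simp
    rw [hV]
    push_cast
    rw [h5]
    linarith
  obtain ⟨c, hc, hpos, hR⟩ := h.exists_coloring hr hdense
  set s : Fin (r ^ 2) → ℕ := fun i => #{v | c v = i} with hs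
  have hE := adjIn_add_sum_sq_add_crossNonadj (G := G) (A := univ) (c := c) fun v _ w _ => hc v w
  rw [← SingularTuran.two_mul_numEdges, card_univ, hV] at hE
  have hT := hR.sum_comp fun x => x ^ 2
  have hTsum := hR.sum_comp fun x => x
  rw [smul_eq_mul] at hT hTsum
  have hsc : ∑ i, s i = r * M := by rw [← hV]; exact sum_card_fiber c
  rw [hsc] at hTsum
  have hTsum' : ∑ x ∈ univ.image s, x = ∑ x ∈ B, x := by
    rw [hBsum]; exact (Nat.eq_of_mul_eq_mul_left hr hTsum).symm
  obtain ⟨k1, k2⟩ := sum_sq_le_of_balanced hBcard hBb (univ.image s) hR.1 hTsum'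
  have k3 := Nat.mul_le_mul_left r k1
  have hE' : 2 * numEdges G + r * ∑ x ∈ univ.image s, x ^ 2 + #(crossNonadj G univ c) =
      (r * M) ^ 2 := by rw [← hT]; exact hE
  refine ⟨by omega, fun _ => ?_⟩
  -- Equality of edge counts leaves no room for larger squares or for a missing cross edge.
  have k4 : r * ∑ x ∈ univ.image s, x ^ 2 ≤ r * ∑ x ∈ B, x ^ 2 := by omega
  have k5 : #(crossNonadj G univ c) = 0 := by omega
  have himage := k2 (Nat.le_of_mul_le_mul_left k4 hr)
  have hG : IsCompletePartite s G := by
    refine isCompletePartite_iff.2 ⟨hpos, c, fun v w => ⟨hc v w, fun hvw => ?_⟩, fun _ => rfl⟩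
    by_contra hcon
    have : (v, w) ∈ crossNonadj G univ c := by simp [crossNonadj, hvw, hcon]
    rw [card_eq_zero.1 k5] at this
    simp at this
  exact hG.nonempty_iso hG₀ hR hs₀ himage

end Upper

/-! ### Adding vertices when `r` does not divide `n` -/

section Adjoin

variable {V : Type*} {m : ℕ}

/-- The graph obtained from `G` by adding `m` independent vertices, each of which is joined to all
vertices that satisfy `P`. -/
def adjoinVertices (G : SimpleGraph V) (P : V → Prop) (m : ℕ) : SimpleGraph (V ⊕ Fin m) where
  Adj
    | .inl v, .inl w => G.Adj v w
    | .inl v, .inr _ => P v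
    | .inr _, .inl w => P w
    | .inr _, .inr _ => False
  symm := ⟨by
    rintro (v | v) (w | w) h
    exacts [G.adj_symm h, h, h, h]⟩
  loopless := ⟨by
    rintro (v | v) h
    exacts [G.loopless.irrefl v h, h]⟩

variable [Fintype V] {G : SimpleGraph V} {P : V → Prop} [DecidablePred P]

lemma degIn_univ_sum {W : Type*} [Fintype W] (H : SimpleGraph (V ⊕ W)) (x : V ⊕ W) :
    degIn H univ x = #{v | H.Adj x (.inl v)} + #{w | H.Adj x (.inr w)} := by
  simp only [degIn, card_filter, Fintype.sum_sum_type]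

lemma degIn_adjoinVertices_inl (v : V) :
    degIn (adjoinVertices G P m) univ (.inl v) = degIn G univ v + if P v then m else 0 := by
  have h1 : ∀ w, (adjoinVertices G P m).Adj (.inl v) (.inl w) ↔ G.Adj v w := fun _ => Iff.rfl
  have h2 : ∀ w, (adjoinVertices G P m).Adj (.inl v) (.inr w) ↔ P v := fun _ => Iff.rfl
  rw [degIn_univ_sum]
  simp only [h1, h2, degIn]
  split_ifs with h <;> simp [h]

lemma degIn_adjoinVertices_inr (j : Fin m) :
    degIn (adjoinVertices G P m) univ (.inr j) = #{v | P v} := by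
  have h1 : ∀ w, (adjoinVertices G P m).Adj (.inr j) (.inl w) ↔ P w := fun _ => Iff.rfl
  have h2 : ∀ w, (adjoinVertices G P m).Adj (.inr j) (.inr w) ↔ False := fun _ => Iff.rfl
  rw [degIn_univ_sum]
  simp only [h1, h2, filter_false, card_empty, add_zero]

lemma numEdges_adjoinVertices :
    numEdges (adjoinVertices G P m) = numEdges G + m * #{v | P v} := by
  have h1 := two_mul_numEdges (adjoinVertices G P m)
  have h2 := two_mul_numEdges G
  simp only [adjIn, Fintype.sum_sum_type, degIn_adjoinVertices_inl, degIn_adjoinVertices_inr,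
    sum_add_distrib] at h1
  have h3 : ∑ v, (if P v then m else 0) = m * #{v | P v} := by
    rw [← sum_filter, sum_const, smul_eq_mul, mul_comm]
  rw [h3] at h1
  simp only [sum_const, card_univ, Fintype.card_fin, smul_eq_mul] at h1
  rw [adjIn] at h2
  omega

/-- Adding independent vertices joined to all parts but those of the largest size keeps a complete
multipartite graph free of singular copies of `K_{r+1}`. -/
lemma singularFree_adjoinVertices {r : ℕ} {s : Fin (r ^ 2) → ℕ} (hr : 2 ≤ r)
    (hpos : ∀ i, 0 < s i) (hR : PropertyR s) {c : V → Fin (r ^ 2)}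
    (hc : ∀ v w, G.Adj v w ↔ c v ≠ c w) (hs : ∀ i, #{v | c v = i} = s i)
    {l : Fin (r ^ 2)} (hl : ∀ i, s i ≤ s l) :
    #{v | s (c v) ≠ s l} + r * s l = Fintype.card V ∧
    SingularFree (SimpleGraph.completeGraph (Fin (r + 1)))
      (adjoinVertices G (fun v => s (c v) ≠ s l) m) := by
  have hcl : #{v | s (c v) = s l} = r * s l := by
    rw [card_eq_sum_card_fiberwise (f := c) (t := {i | s i = s l}) (by
      intro v hv; simpa using hv)]
    have : ∀ i ∈ ({i | s i = s l} : Finset (Fin (r ^ 2))),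
        #{v ∈ ({v | s (c v) = s l} : Finset V) | c v = i} = s l := by
      intro i hi
      have hi' : s i = s l := by simpa using hi
      rw [← hi', ← hs i, filter_filter]
      congr 1
      ext v
      simp only [mem_filter, mem_univ, true_and, and_iff_right_iff_imp]
      rintro rfl
      rw [hs]
    rw [sum_congr rfl this, sum_const, hR.2 _ (by simp), smul_eq_mul]
  have hcard : #{v | s (c v) ≠ s l} + r * s l = Fintype.card V := by
    rw [← hcl, add_comm]
    exact card_filter_add_card_filter_not _
  refine ⟨hcard, ?_⟩
  set H := adjoinVertices G (fun v => s (c v) ≠ s l) m with hH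
  have hdeg : ∀ v, degIn G univ v + s (c v) = Fintype.card V := fun v => by
    rw [← hs, degIn_add_card_fiber (G := G) (c := c) (v := v) (fun u => by rw [hc]; exact ne_comm)]
  have hinl : ∀ v, degIn H univ (.inl v) + s (c v) =
      Fintype.card V + if s (c v) ≠ s l then m else 0 := fun v => by
    rw [hH, degIn_adjoinVertices_inl, ← hdeg v]; ring
  have hinr : ∀ j, degIn H univ (.inr j) + r * s l = Fintype.card V := fun j => by
    rw [hH, degIn_adjoinVertices_inr, hcard]
  have hl0 := hpos l
  have hrl : s l < r * s l := by nlinarith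
  rw [singularFree_completeGraph_iff]
  intro f hf
  set κ : V ⊕ Fin m → ℕ := Sum.elim (fun v => s (c v)) (fun _ => s l) with hκ
  rintro (hsame | hdiff)
  -- New vertices are pairwise nonadjacent and have smaller degree than every old one, because `s l
  -- < r * s l`.
  · have hold : ∀ i, ∃ v, f i = .inl v := by
      intro i
      rcases hfi : f i with v | j
      · exact ⟨v, rfl⟩
      exfalso
      obtain ⟨i', hi'⟩ : ∃ i', i' ≠ i := by
        have : Nontrivial (Fin (r + 1)) := Fin.nontrivial_iff_two_le.2 (by omega)
        exact exists_ne i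
      have hadj := hf i' i hi'
      have hd := hsame i' i
      rw [hfi] at hadj hd
      rcases hfi' : f i' with v | j'
      · rw [hfi'] at hd
        have h1 := hinl v
        have h2 := hinr j
        have h3 := hl (c v)
        omega
      · rw [hfi'] at hadj
        exact hadj
    choose v hv using hold
    simp only [hv] at hf hsame
    have hcv : Function.Injective (c ∘ v) := fun i j hij => by
      by_contra hne
      exact (hc _ _).1 (hf i j hne) hij
    -- Old degrees still determine the part size: the extra `m` only raises degrees that already
    -- exceed those in the largest parts.
    have hclass : ∀ i, s (c (v i)) = s (c (v 0)) := by
      intro i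
      have h1 := hinl (v i)
      have h2 := hinl (v 0)
      have h3 := hsame i 0
      have h4 := hl (c (v i))
      have h5 := hl (c (v 0))
      split_ifs at h1 h2 <;> omega
    have h1 := hR.2 (s (c (v 0))) (by simp)
    have h2 : #(univ.image (c ∘ v)) ≤ #{i | s i = s (c (v 0))} := by
      refine card_le_card fun i hi => ?_
      obtain ⟨j, -, rfl⟩ := mem_image.1 hi
      simp [hclass]
    rw [card_image_of_injective _ hcv, card_univ, Fintype.card_fin, h1] at h2
    omega
  -- New vertices are counted with the largest parts, so `r` sizes serve `r + 1` vertices. Two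
  -- vertices of one size are either both old with equal degrees or nonadjacent.
  · obtain ⟨i, -, j, -, hij, hκij⟩ := exists_ne_map_eq_of_card_lt_of_maps_to
      (s := (univ : Finset (Fin (r + 1)))) (t := univ.image s) (f := κ ∘ f)
      (by rw [hR.1]; simp) (by
        intro i _
        rcases hfi : f i with v | j <;> simp [hκ, hfi])
    have hadj := hf i j hij
    have hd := hdiff i j hij
    simp only [Function.comp] at hκij
    rcases hfi : f i with v | a <;> rcases hfj : f j with w | b <;>
      rw [hfi, hfj] at hadj hκij hd
    · have h0 : s (c v) = s (c w) := hκij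
      have h1 := hinl v
      have h2 := hinl w
      rw [h0] at h1
      omega
    · exact hadj hκij
    · exact hadj hκij.symm
    · exact hadj

end Adjoin

/-! ### Extremal graphs and the two-sided bounds -/

lemma numEdges_le_singularTuranNumber {n : ℕ} {W : Type*} {H : SimpleGraph W}
    {G : SimpleGraph (Fin n)} (h : SingularFree H G) : numEdges G ≤ singularTuranNumber n H :=
  le_sup (f := numEdges) (by simpa using h)

lemma exists_eq_singularTuranNumber {r : ℕ} (hr : 0 < r) (n : ℕ) :
    ∃ G : SimpleGraph (Fin n), SingularFree (SimpleGraph.completeGraph (Fin (r + 1))) G ∧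
      singularTuranNumber n (SimpleGraph.completeGraph (Fin (r + 1))) = numEdges G := by
  have hne : ({G : SimpleGraph (Fin n) |
      SingularFree (SimpleGraph.completeGraph (Fin (r + 1))) G} : Finset _).Nonempty := by
    refine ⟨⊥, ?_⟩
    rw [mem_filter, singularFree_completeGraph_iff]
    refine ⟨mem_univ _, fun f hf => ?_⟩
    have := hf 0 (Fin.last r) (by
      intro h
      have := congrArg Fin.val h
      simp at this
      omega)
    exact absurd this (by simp)
  obtain ⟨G, hG, h⟩ := exists_mem_eq_sup _ hne numEdges
  exact ⟨G, by simpa using hG, h⟩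

/-- The structure of the densest graphs on `r * M` vertices without a singular `K_{r+1}`. -/
lemma extremal_structure_of_dvd {r M : ℕ} (hr : 0 < r) (hM : ∑ i ∈ range r, i + r ≤ M)
    (hM' : r ^ 6 + 4 * r ^ 2 < 2 * (r * M)) :
    singularTuranNumber (r * M) (SimpleGraph.completeGraph (Fin (r + 1))) =
        turanEdges' (r * M) r ∧
      IsGreatest {e : ℕ | ∃ (G : SimpleGraph (Fin (r * M))) (s : Fin (r ^ 2) → ℕ),
          IsCompletePartite s G ∧ PropertyR s ∧ numEdges G = e} (turanEdges' (r * M) r) ∧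
      ∃ G₀ : SimpleGraph (Fin (r * M)),
        IsBalancedPropertyR r G₀ ∧
        (∀ G : SimpleGraph (Fin (r * M)), IsBalancedPropertyR r G → Nonempty (G ≃g G₀)) ∧
        ∀ G : SimpleGraph (Fin (r * M)),
          (SingularFree (SimpleGraph.completeGraph (Fin (r + 1))) G ∧
            numEdges G =
              singularTuranNumber (r * M) (SimpleGraph.completeGraph (Fin (r + 1)))) ↔
          Nonempty (G ≃g G₀) := by
  obtain ⟨B, hB, hBsum, hBb, hBpos⟩ := exists_balanced hr hM
  obtain ⟨s₀, hs₀, himage⟩ := exists_propertyR hB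
  have hmem : ∀ i, s₀ i ∈ B := fun i => by rw [← himage]; simp
  have hb : ∀ i j, s₀ j ≤ s₀ i + r := fun i j => hBb _ (hmem i) _ (hmem j)
  obtain ⟨G₀, hG₀⟩ := exists_isCompletePartite (n := r * M) (fun i => hBpos _ (hmem i))
    (by have := hs₀.sum_comp fun x => x
        rwa [himage, hBsum, smul_eq_mul] at this)
  have hfree := hG₀.singularFree hs₀
  have hbest : ∀ G : SimpleGraph (Fin (r * M)),
      SingularFree (SimpleGraph.completeGraph (Fin (r + 1))) G →
      numEdges G ≤ numEdges G₀ ∧ (numEdges G₀ ≤ numEdges G → Nonempty (G ≃g G₀)) := fun G hG =>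
    hG.numEdges_le_of_balanced hr hG₀ hs₀ hb (by simp) (by simp) hM'
  have hT : singularTuranNumber (r * M) (SimpleGraph.completeGraph (Fin (r + 1))) =
      numEdges G₀ :=
    le_antisymm (Finset.sup_le fun G hG => (hbest G (by simpa using hG)).1)
      (numEdges_le_singularTuranNumber hfree)
  have hT' : turanEdges' (r * M) r = numEdges G₀ :=
    le_antisymm (Finset.sup_le fun G hG => (hbest G (mem_filter.1 hG).2.2).1)
      (le_sup (f := numEdges) (mem_filter.2 ⟨mem_univ _, ⟨s₀, hG₀⟩, hfree⟩))
  refine ⟨hT.trans hT'.symm, ⟨?_, ?_⟩, G₀, ⟨s₀, hG₀, hs₀, hb⟩, ?_, fun G => ⟨?_, ?_⟩⟩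
  · exact ⟨G₀, s₀, hG₀, hs₀, hT'.symm⟩
  · rintro e ⟨G, s, hG, hs, rfl⟩
    rw [hT']
    exact (hbest G (hG.singularFree hs)).1
  · rintro G ⟨s, hG, hs, hbs⟩
    refine hG.nonempty_iso hG₀ hs hs₀ ?_
    rw [himage]
    refine eq_of_sum_eq_of_balanced hs.1 hB ?_ hBb ?_
    · intro x hx y hy
      obtain ⟨i, -, rfl⟩ := mem_image.1 hx
      obtain ⟨j, -, rfl⟩ := mem_image.1 hy
      exact hbs i j
    · have h1 := hs.sum_comp fun x => x
      rw [hG.sum_eq, Fintype.card_fin, smul_eq_mul] at h1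
      rw [hBsum]
      exact (Nat.eq_of_mul_eq_mul_left hr h1).symm
  · rintro ⟨hG, he⟩
    exact (hbest G hG).2 (by rw [he, hT])
  · rintro ⟨e⟩
    exact ⟨hfree.iso e.symm, by rw [hT, numEdges_iso e]⟩

/-- Exceeding the bound would give a colouring that forces `r ∣ n`. For `√n ≤ r ^ 2` Turán's bound
suffices since `n / r ^ 2 ≤ √n`; beyond that, `√n` outweighs the constants of the density threshold.
-/
lemma singularTuranNumber_le_of_not_dvd {r n : ℕ} (hr : 3 ≤ r) (hn : ¬ r ∣ n) :
    (singularTuranNumber n (SimpleGraph.completeGraph (Fin (r + 1))) : ℝ) ≤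
      (turanEdges n (r ^ 2) : ℝ) - (n : ℝ) / (r : ℝ) ^ 2 + Real.sqrt (n : ℝ) := by
  have hr0 : 0 < r := by omega
  have hq9 : (9 : ℝ) ≤ (r : ℝ) ^ 2 := by
    have : (3 : ℝ) ≤ r := by exact_mod_cast hr
    nlinarith
  obtain ⟨G, hG, hT⟩ := exists_eq_singularTuranNumber hr0 n
  rw [hT]
  have hsq := Real.sq_sqrt (Nat.cast_nonneg n : (0 : ℝ) ≤ n)
  have hs0 := Real.sqrt_nonneg (n : ℝ)
  set x := Real.sqrt (n : ℝ) with hx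
  have hturan : (numEdges G : ℝ) ≤ turanEdges n (r ^ 2) := by
    exact_mod_cast hG.numEdges_le_turanEdges hr0
  by_cases hxq : x ≤ (r : ℝ) ^ 2
  · have : (n : ℝ) / (r : ℝ) ^ 2 ≤ x := by
      rw [div_le_iff₀ (by positivity)]
      nlinarith
    linarith
  · by_contra! hlt
    have hb := (two_mul_turanEdges_bounds (q := r ^ 2) n (pow_pos hr0 2)).1
    push_cast at hb
    obtain ⟨c, hc, hpos, hR⟩ := hG.exists_coloring hr0 (by
      rw [Fintype.card_fin]
      have : 2 * (n : ℝ) / (r : ℝ) ^ 2 = 2 * ((n : ℝ) / (r : ℝ) ^ 2) := by ring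
      linarith)
    refine hn ?_
    have := hR.dvd_sum
    rwa [sum_card_fiber, Fintype.card_fin] at this

/-- The error terms come from the spread of the part sizes (`r ^ 4`), from the largest part
exceeding the mean in the degrees of the `m` new vertices (`m * r ^ 2 ≤ r ^ 3`), and from the edges
lost among the new vertices (`m ^ 2 ≤ r ^ 2`). -/
lemma lower_bound_of_le {r k m : ℕ} (hr : 2 ≤ r) (hk : ∑ i ∈ range r, i + r ≤ k) (hm : m < r) :
    (turanEdges (r * k + m) (r ^ 2) : ℝ) - (m : ℝ) * (((r : ℝ) - 1) / (r : ℝ) ^ 2) *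
        ((r * k + m : ℕ) : ℝ) - ((r : ℝ) ^ 4 + (r : ℝ) ^ 3 + (r : ℝ) ^ 2) ≤
      (singularTuranNumber (r * k + m) (SimpleGraph.completeGraph (Fin (r + 1))) : ℝ) := by
  have hr0 : 0 < r := by omega
  have hr0' : (0 : ℝ) < r := by exact_mod_cast hr0
  obtain ⟨B, hB, hBsum, hBb, hBpos⟩ := exists_balanced hr0 hk
  obtain ⟨s, hs, himage⟩ := exists_propertyR hB
  have hmem : ∀ i, s i ∈ B := fun i => by rw [← himage]; simp
  obtain ⟨G₀, hG₀⟩ := exists_isCompletePartite (n := r * k) (fun i => hBpos _ (hmem i))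
    (by have := hs.sum_comp fun x => x
        rwa [himage, hBsum, smul_eq_mul] at this)
  obtain ⟨hpos, c, hc, hcs⟩ := isCompletePartite_iff.1 hG₀
  have : Nonempty (Fin (r ^ 2)) := ⟨⟨0, pow_pos hr0 2⟩⟩
  obtain ⟨l, hl⟩ := Finite.exists_max s
  obtain ⟨hcard, hfree⟩ := singularFree_adjoinVertices (m := m) hr hpos hs hc hcs hl
  rw [Fintype.card_fin] at hcard
  have hedges := numEdges_adjoinVertices (G := G₀) (P := fun v => s (c v) ≠ s l) (m := m)
  set H := adjoinVertices G₀ (fun v => s (c v) ≠ s l) m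
  have e : Fin (r * k) ⊕ Fin m ≃ Fin (r * k + m) := finSumFinEquiv
  have hiso : H ≃g H.map e.toEmbedding := SimpleGraph.Iso.map e H
  have hT := numEdges_le_singularTuranNumber (hfree.iso hiso)
  rw [← numEdges_iso hiso, hedges] at hT
  have hE₀ := hG₀.two_mul_numEdges
  rw [hs.sum_comp fun x => x ^ 2, smul_eq_mul, himage, Fintype.card_fin] at hE₀
  have hE₀' : 2 * (numEdges G₀ : ℝ) + r * ∑ x ∈ B, (x : ℝ) ^ 2 = ((r : ℝ) * k) ^ 2 := by
    exact_mod_cast hE₀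
  have hBsum' : ∑ x ∈ B, (x : ℝ) = k := by rw [← hBsum, Nat.cast_sum]
  have hsq := sum_sq_le_of_diam hr0 hB hBb
  have hmean := (abs_le.1 (abs_sub_mean_le_of_balanced hr0 hB hBb (hmem l))).2
  rw [hBsum'] at hsq hmean
  have h3 : (r : ℝ) * ∑ x ∈ B, (x : ℝ) ^ 2 ≤ k ^ 2 + (r : ℝ) ^ 4 := by
    refine (mul_le_mul_of_nonneg_left hsq hr0'.le).trans_eq ?_
    field_simp
  have h4 : (r : ℝ) * s l ≤ k + (r : ℝ) ^ 2 := by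
    have := mul_le_mul_of_nonneg_left (sub_le_iff_le_add.1 hmean) hr0'.le
    refine this.trans_eq ?_
    field_simp
    ring
  have hcard' : (#{v | s (c v) ≠ s l} : ℝ) + r * s l = r * k := by exact_mod_cast hcard
  have hT' : (numEdges G₀ : ℝ) + m * #{v | s (c v) ≠ s l} ≤
      singularTuranNumber (r * k + m) (SimpleGraph.completeGraph (Fin (r + 1))) := by
    exact_mod_cast hT
  have hb := (two_mul_turanEdges_bounds (q := r ^ 2) (r * k + m) (pow_pos hr0 2)).2
  push_cast at hb ⊢
  have hmr : (m : ℝ) ≤ r := by exact_mod_cast hm.le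
  have hm0 : (0 : ℝ) ≤ m := Nat.cast_nonneg m
  have h5 : (m : ℝ) * (r * k - k - (r : ℝ) ^ 2) ≤ m * #{v | s (c v) ≠ s l} :=
    mul_le_mul_of_nonneg_left (by linarith) hm0
  have h6 : (1 - 1 / (r : ℝ) ^ 2) * ((r : ℝ) * k + m) ^ 2 / 2 -
      (m : ℝ) * (((r : ℝ) - 1) / (r : ℝ) ^ 2) * (r * k + m) =
      ((r * k) ^ 2 - (k : ℝ) ^ 2) / 2 + m * (r * k - k) +
        (m : ℝ) ^ 2 / 2 - (m : ℝ) ^ 2 * (1 / (2 * (r : ℝ) ^ 2) + (r - 1) / (r : ℝ) ^ 2) := by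
    field_simp
    ring
  have hr1 : (0 : ℝ) ≤ r - 1 := by
    have : (1 : ℝ) ≤ r := by exact_mod_cast hr0
    linarith
  have h7 : 0 ≤ (m : ℝ) ^ 2 * (1 / (2 * (r : ℝ) ^ 2) + (r - 1) / (r : ℝ) ^ 2) := by positivity
  have h8 : (m : ℝ) ^ 2 ≤ (r : ℝ) ^ 2 := by gcongr
  have h9 : (m : ℝ) * (r : ℝ) ^ 2 ≤ (r : ℝ) ^ 3 := by
    rw [pow_succ' _ 2]
    gcongr
  have h10 : (0 : ℝ) ≤ (r : ℝ) ^ 4 := by positivity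
  nlinarith

lemma exists_lower_bound (r : ℕ) (hr : 2 ≤ r) : ∃ C : ℝ, ∀ n k m : ℕ, n = r * k + m → m < r →
    (turanEdges n (r ^ 2) : ℝ) - (m : ℝ) * (((r : ℝ) - 1) / (r : ℝ) ^ 2) * (n : ℝ) + C ≤
      (singularTuranNumber n (SimpleGraph.completeGraph (Fin (r + 1))) : ℝ) := by
  set K := ∑ i ∈ range r, i + r with hK
  set D : ℝ := ((r * K + r : ℕ) : ℝ) ^ 2 with hD
  set E : ℝ := (r : ℝ) ^ 4 + (r : ℝ) ^ 3 + (r : ℝ) ^ 2 with hE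
  have hE0 : 0 ≤ E := by positivity
  have hD0 : 0 ≤ D := by positivity
  refine ⟨-(D + E), ?_⟩
  rintro n k m rfl hm
  rcases le_or_gt K k with hk | hk
  · have := lower_bound_of_le hr hk hm
    rw [← hE] at this
    linarith
  -- Only boundedly many `n` remain, and `D` exceeds their Turán numbers, so the left side is
  -- nonpositive.
  · have hb := (two_mul_turanEdges_bounds (q := r ^ 2) (r * k + m) (pow_pos (by omega) 2)).2
    have hn : ((r * k + m : ℕ) : ℝ) ≤ ((r * K + r : ℕ) : ℝ) := by
      exact_mod_cast Nat.add_le_add (Nat.mul_le_mul_left r hk.le) hm.le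
    have hn2 : ((r * k + m : ℕ) : ℝ) ^ 2 ≤ D := by rw [hD]; gcongr
    have h1 : (1 - 1 / ((r ^ 2 : ℕ) : ℝ)) * ((r * k + m : ℕ) : ℝ) ^ 2 ≤
        ((r * k + m : ℕ) : ℝ) ^ 2 := by
      refine mul_le_of_le_one_left (sq_nonneg _) ?_
      have : 0 ≤ 1 / ((r ^ 2 : ℕ) : ℝ) := by positivity
      linarith
    have hr1 : (0 : ℝ) ≤ r - 1 := by
      have : (2 : ℝ) ≤ r := by exact_mod_cast hr
      linarith
    have h2 : 0 ≤ (m : ℝ) * (((r : ℝ) - 1) / (r : ℝ) ^ 2) * ((r * k + m : ℕ) : ℝ) := by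
      positivity
    have h3 : (0 : ℝ) ≤
        (singularTuranNumber (r * k + m) (SimpleGraph.completeGraph (Fin (r + 1))) : ℝ) :=
      Nat.cast_nonneg _
    linarith

end SingularTuran

theorem theorem3 (r : ℕ) (hr : 3 ≤ r) :
    (∃ N : ℕ, ∀ n : ℕ, N ≤ n → r ∣ n →
      SingularTuran.singularTuranNumber n (SimpleGraph.completeGraph (Fin (r + 1))) =
        SingularTuran.turanEdges' n r ∧
      IsGreatest {e : ℕ | ∃ (G : SimpleGraph (Fin n)) (s : Fin (r ^ 2) → ℕ),
          SingularTuran.IsCompletePartite s G ∧ SingularTuran.PropertyR s ∧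
          SingularTuran.numEdges G = e}
        (SingularTuran.turanEdges' n r) ∧
      ∃ G₀ : SimpleGraph (Fin n),
        SingularTuran.IsBalancedPropertyR r G₀ ∧
        (∀ G : SimpleGraph (Fin n),
          SingularTuran.IsBalancedPropertyR r G → Nonempty (G ≃g G₀)) ∧
        ∀ G : SimpleGraph (Fin n),
          (SingularTuran.SingularFree (SimpleGraph.completeGraph (Fin (r + 1))) G ∧
            SingularTuran.numEdges G =
              SingularTuran.singularTuranNumber n (SimpleGraph.completeGraph (Fin (r + 1)))) ↔
          Nonempty (G ≃g G₀)) ∧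
    (∃ C : ℝ, ∀ n k m : ℕ, n = r * k + m → 1 ≤ m → m < r →
      (SingularTuran.turanEdges n (r ^ 2) : ℝ) - (m : ℝ) * (((r : ℝ) - 1) / (r : ℝ) ^ 2) * (n : ℝ)
          + C ≤
        (SingularTuran.singularTuranNumber n (SimpleGraph.completeGraph (Fin (r + 1))) : ℝ) ∧
      (SingularTuran.singularTuranNumber n (SimpleGraph.completeGraph (Fin (r + 1))) : ℝ) ≤
        (SingularTuran.turanEdges n (r ^ 2) : ℝ) - (n : ℝ) / (r : ℝ) ^ 2 + Real.sqrt (n : ℝ)) := by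
  have hr0 : 0 < r := by omega
  obtain ⟨C, hC⟩ := SingularTuran.exists_lower_bound r (by omega)
  -- The first summand ensures positive part sizes in the balanced graph, the second the density
  -- threshold.
  refine ⟨⟨r * (∑ i ∈ Finset.range r, i + r) + (r ^ 6 + 4 * r ^ 2 + 1), ?_⟩, C,
    fun n k m hn hm hmr => ⟨hC n k m hn hmr,
      SingularTuran.singularTuranNumber_le_of_not_dvd hr fun hdvd => ?_⟩⟩
  · rintro n hN ⟨M, rfl⟩
    exact SingularTuran.extremal_structure_of_dvd hr0
      (le_of_mul_le_mul_left (by omega) hr0) (by omega)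
  · rw [hn, Nat.dvd_add_right (dvd_mul_right r k)] at hdvd
    exact absurd (Nat.le_of_dvd hm hdvd) (by omega)
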